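/- Let $\mathbb D$ be the open unit disc, $\mathbb T$ the unit circle with normalized Lebesgue measure $m$, and let $\Lambda=(\lambda_n)_{n\in\mathbb N}$ be a sequence in $\mathbb D$ (repetitions allowed). When it converges, its Blaschke product is $$B_\Lambda(z)=\prod_{n}\frac{|\lambda_n|}{\lambda_n}\,\frac{\lambda_n-z}{1-\overline{\lambda_n}z},\qquad z\in\mathbb D,$$ where the factor is $z$ if $\lambda_n=0$. For $\zeta\in\mathbb T$, $N\ge 1$ and a function $f$ in the Hardy space $H^2$ put $$D^N_\zeta(f)=\inf\Big\{\Big\|\frac{f-p}{(z-\zeta)^N}\Big\|_{H^2}^2:\ p \text{ a polynomial of degree}<N\Big\}\in[0,\infty].$$ (1) Let $\zeta\in\mathbb T$ and let $N\ge 1$ be an integer. If $\sum_n \frac{1-|\lambda_n|^2}{|\zeta-\lambda_n|^{2N}}<\infty$, then the product $B_\Lambda$ converges on $\mathbb D$, $D^N_\zeta(B_\Lambda)<\infty$, and the radial limit $B_\Lambda(\zeta)=\lim_{r\to1^-}B_\Lambda(r\zeta)$ exists with $|B_\Lambda(\zeta)|=1$. (2) Let $b$ be a rational function in $H^\infty$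 with $\|b\|_{H^\infty}=1$ that is non-extreme, i.e. $\int_{\mathbb T}\log(1-|b|)\,dm>-\infty$, and let $a$ be its Pythagorean mate, i.e. the (rational) outer function with $a(0)>0$ and $|a|^2+|b|^2=1$ on $\mathbb T$. Let $\zeta_1,\dots,\zeta_l$ be the distinct zeros of $a$ on $\mathbb T$, with multiplicities $m_1,\dots,m_l$. Let $\mathcal H(b)$ be the de Branges–Rovnyak space, i.e. the reproducing kernel Hilbert space on $\mathbb D$ with kernel $k_w(z)=\frac{1-\overline{b(w)}b(z)}{1-\overline w z}$, and let $\mathcal M(\mathcal H(b))=\{\varphi:\mathbb D\to\mathbb C:\ \varphi f\in\mathcal H(b)\text{ for all } f\in\mathcal H(b)\}$ be its multiplier algebra. If $$\sum_{n}\frac{1-|\lambda_n|^2}{|\zeta_j-\lambda_n|^{2m_j}}<\infty\qquad\text{for every }1\le j\le l,$$ then the product $B_\Lambda$ converges on $\mathbb D$, $D^{m_j}_{\zeta_j}(B_\Lambda)<\infty$ and $|B_\Lambda(\zeta_j)|=1$ (as a radial limit) for every $j$, $B_\Lambda\in\mathcal H(b)$, and $B_\Lambda\in\mathcal M(\mathcal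 H(b))$. -/

import Mathlib

open Complex UnitDisc Filter Topology MeasureTheory Polynomial
open scoped ENNReal ComplexConjugate

noncomputable section

/-- The value at `z` of a rational function, written in lowest terms. -/
def ratEval (f : RatFunc ℂ) (z : ℂ) : ℂ := f.eval (RingHom.id ℂ) z

/-- The multiplicity of `ζ` as a zero of a rational function. The numerator is coprime to the
denominator, so a zero of the numerator is a zero of the function, with the same multiplicity. -/
def zeroMultiplicity (f : RatFunc ℂ) (ζ : ℂ) : ℕ := f.num.rootMultiplicity ζ

/-- `f` is outer: on the disc it is a unimodular constant times the exponential of the Herglotz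
integral of `log |f|`, the latter being integrable on the unit circle. The function `f` is given
on the open disc together with its boundary values on the circle. -/
def IsOuter (f : ℂ → ℂ) : Prop :=
  CircleIntegrable (fun ζ => Real.log ‖f ζ‖) 0 1 ∧
  ∃ c : ℂ, ‖c‖ = 1 ∧ ∀ z : 𝔻, f z = c * Complex.exp
    (Real.circleAverage (fun ζ : ℂ => (ζ + z) / (ζ - z) * (Real.log ‖f ζ‖ : ℂ)) 0 1)

/-- `∫ log (1 - |b|) dm > -∞` over the unit circle. Since `Real.log 0 = 0`, the requirement that
`|b| < 1` almost everywhere is stated separately. -/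
def IsNonextreme (b : ℂ → ℂ) : Prop :=
  (∀ᵐ θ : ℝ, ‖b (circleMap 0 1 θ)‖ < 1) ∧
  CircleIntegrable (fun ζ => Real.log (1 - ‖b ζ‖)) 0 1

/-- `b` has norm `1` in `H^∞`. For a rational function this includes having no pole in the open
disc, since the function is unbounded near a pole. -/
def HasSupNormOne (b : RatFunc ℂ) : Prop :=
  IsLUB (Set.range fun z : 𝔻 => ‖ratEval b z‖) 1

/-- `a` is the Pythagorean mate of `b`: the outer function with `a(0) > 0` and
`|a|² + |b|² = 1` on the unit circle. -/
def IsPythagoreanMate (a b : RatFunc ℂ) : Prop :=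
  IsOuter (ratEval a) ∧ 0 < (ratEval a 0).re ∧ (ratEval a 0).im = 0 ∧
  ∀ ζ : ℂ, ‖ζ‖ = 1 → ‖ratEval a ζ‖ ^ 2 + ‖ratEval b ζ‖ ^ 2 = 1

/-- The de Branges-Rovnyak space `H(b)`, as a set of functions on the disc: the functions in the
reproducing kernel Hilbert space with kernel
`k_w(z) = (1 - conj (b w) * b z) / (1 - conj w * z)`.
All Hilbert spaces with this kernel consist of the same functions (Moore-Aronszajn). -/
def deBrangesRovnyak (b : 𝔻 → ℂ) : Set (𝔻 → ℂ) :=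
  {f | ∃ (H : Type) (_ : NormedAddCommGroup H) (_ : InnerProductSpace ℂ H) (_ : CompleteSpace H)
    (_ : RKHS ℂ H 𝔻 ℂ),
    (∀ z w : 𝔻, RKHS.kernel H z w 1 = (1 - conj (b w) * b z) / (1 - conj (w : ℂ) * (z : ℂ))) ∧
    ∃ h : H, ⇑h = f}

/-- The multipliers of a set of functions on the disc. -/
def multipliers (S : Set (𝔻 → ℂ)) : Set (𝔻 → ℂ) := {φ | ∀ f ∈ S, φ * f ∈ S}

/-- The normalized Blaschke factor with zero `w`; it is `z` when `w = 0`. -/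
def blaschkeFactor (w z : ℂ) : ℂ :=
  if w = 0 then z else (‖w‖ : ℂ) / w * ((w - z) / (1 - conj w * z))

/-- The Blaschke product with zeros `Λ 0, Λ 1, …`, counted with repetitions. -/
def blaschkeProduct (Λ : ℕ → 𝔻) (z : ℂ) : ℂ := ∏' n, blaschkeFactor (Λ n) z

/-- The square of the `H²` norm (possibly infinite):
`sup_{0 < r < 1} ∫ |f(rζ)|² dm(ζ)` with `m` the normalized Lebesgue measure on the circle. -/
def hardyNormSq (f : ℂ → ℂ) : ℝ≥0∞ :=
  ⨆ r ∈ Set.Ioo (0 : ℝ) 1, (ENNReal.ofReal (2 * Real.pi))⁻¹ *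
    ∫⁻ θ in Set.Ioc (0 : ℝ) (2 * Real.pi), ‖f (circleMap 0 r θ)‖ₑ ^ 2

/-- The local Dirichlet integral of order `N` at `ζ`: the infimum of
`‖(f - p) / (z - ζ)^N‖²` (norm of `H²`) over the polynomials `p` of degree less than `N`. -/
def localDirichletIntegral (N : ℕ) (ζ : ℂ) (f : ℂ → ℂ) : ℝ≥0∞ :=
  ⨅ p ∈ Polynomial.degreeLT ℂ N, hardyNormSq fun z => (f z - p.eval z) / (z - ζ) ^ N

/-- The radial limit of `f` at the boundary point `ζ` exists and has modulus one. -/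
def HasUnimodularRadialLimit (f : ℂ → ℂ) (ζ : ℂ) : Prop :=
  ∃ w : ℂ, Tendsto (fun r : ℝ => f (r * ζ)) (𝓝[<] 1) (𝓝 w) ∧ ‖w‖ = 1

/-- `∑ (1 - |λ_n|²) / |ζ - λ_n|^(2m) < ∞`; all the terms are nonnegative. -/
def SummableAt (Λ : ℕ → 𝔻) (ζ : ℂ) (m : ℕ) : Prop :=
  Summable fun n => (1 - ‖(Λ n : ℂ)‖ ^ 2) / ‖ζ - (Λ n : ℂ)‖ ^ (2 * m)

end

/-! Let `p₀` be the monic polynomial whose zeros are the circle zeros of the mate `a`, with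
multiplicity. The second claim rests on the identity H(b) = p₀H² + polynomials
(`mem_deBrangesRovnyak_ratEval_iff`). Once the Blaschke product is written as B = P + p₀h with P a
polynomial and h in H², membership is immediate, and B(p₀x + r) = p₀(Bx + rh) + Pr shows that B is a
multiplier, since B preserves H².

The expansion of B is first found at a single point ζ, to order N (`SummableAt.exists_taylor`), by
multiplying in one factor b_w at a time. Put ε = (1 - |w|²)/|ζ - w|^(2N). The sum of the moduli of
the Taylor coefficients grows at most by the factor 1 + N4^N ε. The remainder h becomes b_w h + c
k_w, with k_w the Szegő kernel; b_w h vanishes at w, so the summands are orthogonal and the squared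
norms add, with an increment of order ε. This is the origin of the exponent 2N. The bounds are
uniform along partial products, and compactness gives the limit. The first claim is read off from
this expansion; `exists_eq_eval_add_of_local` glues the expansions at the various zeros.

For the description of H(b), write b = q/d and a = p/d. The pairs (f, g) in H² ⊕ H² with T_q^* f =
T_p^* g form a space with the required kernel (`mem_deBrangesRovnyak_iff`), because T_p^* T_p +
T_q^* T_q = T_d^* T_d. Since q is coprime to p₀ and p/p₀ has no zero in the closed disc, f ranges
over the range of T_{p₀}^*, which is p₀H² + polynomials (`exists_aeval_back_eq_iff`). -/

noncomputable section

/-! ### The Hardy space: shifts, point evaluations, division, compactness. -/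

/-- The Hardy space `H²`, realised through Taylor coefficients. -/
abbrev Hardy : Type := lp (fun _ : ℕ => ℂ) 2

namespace Hardy

lemma memℓp_iff {f : ℕ → ℂ} : Memℓp f 2 ↔ Summable fun n => ‖f n‖ ^ 2 := by
  rw [memℓp_gen_iff (by norm_num)]
  simp

lemma norm_sq_eq (x : Hardy) : ‖x‖ ^ 2 = ∑' n, ‖x n‖ ^ 2 := by
  have := lp.norm_rpow_eq_tsum (p := 2) (by norm_num) x
  simpa using this

lemma summable_sq (x : Hardy) : Summable fun n => ‖x n‖ ^ 2 := memℓp_iff.1 (lp.memℓp x)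

/-- The coefficients of `z f(z)`. -/
def shiftFun (f : ℕ → ℂ) : ℕ → ℂ
  | 0 => 0
  | n + 1 => f n

lemma memℓp_shiftFun (x : Hardy) : Memℓp (shiftFun x) 2 := by
  rw [memℓp_iff, ← summable_nat_add_iff 1]
  exact x.summable_sq

/-- Multiplication by the coordinate function on `H²`. -/
def shiftIsometry : Hardy →ₗᵢ[ℂ] Hardy where
  toFun x := ⟨shiftFun x, memℓp_shiftFun x⟩
  map_add' x y := by
    ext n
    change shiftFun (x + y : Hardy) n = shiftFun x n + shiftFun y n
    cases n <;> simp [shiftFun]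
  map_smul' c x := by
    ext n; cases n <;> simp [shiftFun]
  norm_map' x := by
    refine (sq_eq_sq₀ (norm_nonneg _) (norm_nonneg _)).1 ?_
    rw [norm_sq_eq, norm_sq_eq]
    have h : Summable fun n => ‖shiftFun x n‖ ^ 2 := memℓp_iff.1 (memℓp_shiftFun x)
    simpa [shiftFun] using h.tsum_eq_zero_add

/-- The shift operator on `H²`. -/
def shift : Hardy →L[ℂ] Hardy := shiftIsometry.toContinuousLinearMap

@[simp] lemma shift_zero (x : Hardy) : shift x 0 = 0 := rfl
@[simp] lemma shift_succ (x : Hardy) (n : ℕ) : shift x (n + 1) = x n := rfl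

@[simp] lemma norm_shift (x : Hardy) : ‖shift x‖ = ‖x‖ := shiftIsometry.norm_map x

/-- The backward shift. -/
def back : Hardy →L[ℂ] Hardy := shift.adjoint

lemma back_mul_shift : back * shift = 1 := by
  ext1 x
  refine ext_inner_left ℂ fun y => ?_
  simp only [back, mul_apply_eq_comp, ContinuousLinearMap.adjoint_inner_right]
  exact shiftIsometry.inner_map_map y x

@[simp] lemma back_shift (x : Hardy) : back (shift x) = x :=
  DFunLike.congr_fun back_mul_shift x

@[simp] lemma back_apply (x : Hardy) (n : ℕ) : back x n = x (n + 1) := by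
  have h := ContinuousLinearMap.adjoint_inner_right shift (lp.single 2 n (1 : ℂ) : Hardy) x
  rw [lp.inner_single_left] at h
  have h2 : shift (lp.single 2 n (1 : ℂ) : Hardy) = lp.single 2 (n + 1) (1 : ℂ) := by
    ext k
    cases k with
    | zero => simp
    | succ k => simp [Pi.single_apply]
  rw [h2, lp.inner_single_left] at h
  simpa [back] using h

/-- The constant function `1`. -/
def one : Hardy := lp.single 2 0 (1 : ℂ)

lemma sub_shift_back (x : Hardy) : x - shift (back x) = x 0 • one := by
  ext k
  cases k with
  | zero => simp [one]
  | succ k => simp [one]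

@[simp] lemma back_one : back one = 0 := by
  ext k
  simp [one]

lemma memℓp_szego (w : 𝔻) : Memℓp (fun n => conj (w : ℂ) ^ n) 2 := by
  rw [memℓp_iff]
  simp_rw [norm_pow, ← pow_mul, mul_comm _ 2, pow_mul]
  refine summable_geometric_of_lt_one (by positivity) ?_
  have := w.norm_lt_one
  simp only [RCLike.norm_conj]
  nlinarith [norm_nonneg (w : ℂ)]

/-- The Szegő kernel at `w`. -/
def szego (w : 𝔻) : Hardy := ⟨fun n => conj (w : ℂ) ^ n, memℓp_szego w⟩

@[simp] lemma szego_apply (w : 𝔻) (n : ℕ) : szego w n = conj (w : ℂ) ^ n := rfl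

/-- The value of an element of `H²` at a point of the disc. -/
def ev (z : 𝔻) : Hardy →L[ℂ] ℂ := innerSL ℂ (szego z)

lemma ev_eq_inner (z : 𝔻) (x : Hardy) : ev z x = inner ℂ (szego z) x := rfl

lemma hasSum_ev (z : 𝔻) (x : Hardy) : HasSum (fun n => x n * (z : ℂ) ^ n) (ev z x) := by
  simpa [ev_eq_inner] using lp.hasSum_inner (𝕜 := ℂ) (szego z) x

@[simp] lemma back_szego (w : 𝔻) : back (szego w) = conj (w : ℂ) • szego w := by
  ext n
  simp [pow_succ, mul_comm]

@[simp] lemma ev_shift (z : 𝔻) (x : Hardy) : ev z (shift x) = z * ev z x := by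
  rw [ev_eq_inner, ← ContinuousLinearMap.adjoint_inner_left]
  change inner ℂ (back (szego z)) x = _
  rw [back_szego, inner_smul_left, ev_eq_inner]
  simp

@[simp] lemma ev_one (z : 𝔻) : ev z one = 1 := by
  rw [ev_eq_inner, one, lp.inner_single_right]
  simp

@[simp] lemma ev_aeval_shift (z : 𝔻) (p : ℂ[X]) (x : Hardy) :
    ev z (aeval shift p x) = p.eval (z : ℂ) * ev z x := by
  induction p using Polynomial.induction_on' with
  | add p q hp hq => simp [hp, hq, add_mul]
  | monomial n a =>
    have h (n : ℕ) : ev z ((shift ^ n) x) = (z : ℂ) ^ n * ev z x := by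
      induction n with
      | zero => simp
      | succ n ih => rw [pow_succ', mul_apply_eq_comp, ev_shift, ih]; ring
    rw [aeval_monomial, mul_apply_eq_comp, Algebra.algebraMap_eq_smul_one]
    simp only [smul_apply, one_apply_eq_self, map_smul, h, eval_monomial]
    simp [mul_assoc]

lemma ev_szego (z w : 𝔻) : ev z (szego w) = (1 - conj (w : ℂ) * z)⁻¹ := by
  refine (hasSum_ev z _).unique ?_
  have h : ‖conj (w : ℂ) * z‖ < 1 := by
    rw [norm_mul, RCLike.norm_conj]
    nlinarith [w.norm_lt_one, z.norm_lt_one, norm_nonneg (w : ℂ), norm_nonneg (z : ℂ)]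
  simpa [mul_pow] using hasSum_geometric_of_norm_lt_one h

lemma norm_szego_sq (w : 𝔻) : ‖szego w‖ ^ 2 = (1 - ‖(w : ℂ)‖ ^ 2)⁻¹ := by
  have h := ev_szego w w
  rw [ev_eq_inner, inner_self_eq_norm_sq_to_K, conj_mul'] at h
  apply Complex.ofReal_injective
  push_cast
  exact h

lemma norm_ev_le (z : 𝔻) (x : Hardy) : ‖ev z x‖ ^ 2 ≤ ‖x‖ ^ 2 / (1 - ‖(z : ℂ)‖ ^ 2) := by
  rw [div_eq_mul_inv, ← norm_szego_sq, ← mul_pow, mul_comm, ev_eq_inner]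
  gcongr
  exact norm_inner_le_norm _ _

/-- From x = x 0 + z · `back x`, vanishing at a small t > 0 bounds |x 0| by a multiple of t. The
origin is excluded from the hypothesis so that `ext_ev` can divide by z and iterate. -/
lemma coeff_zero_eq_zero {x : Hardy} (h : ∀ z : 𝔻, z ≠ 0 → ev z x = 0) : x 0 = 0 := by
  have hb : ∀ t ∈ Set.Ioo (0 : ℝ) (1 / 2), ‖x 0‖ ^ 2 ≤ t ^ 2 * (2 * ‖back x‖ ^ 2) := by
    intro t ht
    have ht1 : ‖(t : ℂ)‖ < 1 := by
      rw [norm_real, Real.norm_of_nonneg ht.1.le]; linarith [ht.2]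
    let z : 𝔻 := UnitDisc.mk t ht1
    have hz : (z : ℂ) = t := rfl
    have hz0 : z ≠ 0 := by
      intro h0
      have : (z : ℂ) = 0 := by rw [h0]; rfl
      rw [hz] at this
      exact ht.1.ne' (by exact_mod_cast this)
    have h1 := congrArg (ev z) (sub_shift_back x)
    simp only [map_sub, h z hz0, ev_shift, map_smul, ev_one, smul_eq_mul, mul_one, zero_sub] at h1
    have h2 := norm_ev_le z (back x)
    rw [← h1, norm_neg, norm_mul, mul_pow, hz, norm_real, Real.norm_of_nonneg ht.1.le]
    rw [hz, norm_real, Real.norm_of_nonneg ht.1.le] at h2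
    gcongr
    refine h2.trans ?_
    rw [div_le_iff₀ (by nlinarith [ht.1, ht.2])]
    nlinarith [ht.1, ht.2, sq_nonneg ‖back x‖,
      mul_nonneg (sq_nonneg ‖back x‖) (by nlinarith [ht.1, ht.2] : (0 : ℝ) ≤ 1 - 2 * t ^ 2)]
  have hlim : Tendsto (fun t : ℝ => t ^ 2 * (2 * ‖back x‖ ^ 2)) (𝓝[>] 0) (𝓝 0) := by
    have : Continuous fun t : ℝ => t ^ 2 * (2 * ‖back x‖ ^ 2) := by fun_prop
    simpa using (this.tendsto 0).mono_left nhdsWithin_le_nhds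
  have := ge_of_tendsto hlim (by
    filter_upwards [Ioo_mem_nhdsGT (show (0 : ℝ) < 1 / 2 by norm_num)] with t ht using hb t ht)
  simpa using le_antisymm this (sq_nonneg _)

lemma ext_ev {x y : Hardy} (h : ∀ z, ev z x = ev z y) : x = y := by
  rw [← sub_eq_zero]
  have key (n : ℕ) : ∀ u : Hardy, (∀ z : 𝔻, z ≠ 0 → ev z u = 0) → u n = 0 := by
    induction n with
    | zero => exact fun u hu => coeff_zero_eq_zero hu
    | succ n ih =>
      intro u hu
      rw [← back_apply]
      refine ih _ fun z hz => ?_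
      have h1 := congrArg (ev z) (sub_shift_back u)
      simpa [coeff_zero_eq_zero hu, hu z hz, hz] using h1
  ext n
  exact key n _ fun z _ => by simp [h]

lemma norm_shift_le : ‖shift‖ ≤ 1 :=
  ContinuousLinearMap.opNorm_le_bound _ zero_le_one fun x => by simp

lemma norm_back_le : ‖back‖ ≤ 1 := by
  rw [back, LinearIsometryEquiv.norm_map]
  exact norm_shift_le

/-- Spectral mapping: the spectrum of a contraction lies in the closed disc, where `p` has no zero.
-/
lemma isUnit_aeval {T : Hardy →L[ℂ] Hardy} (hT : ‖T‖ ≤ 1) {p : ℂ[X]}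
    (hp : ∀ z : ℂ, ‖z‖ ≤ 1 → p.eval z ≠ 0) : IsUnit (aeval T p) := by
  have : Nontrivial Hardy := ⟨one, 0, fun h => by
    have := congrArg (fun x : Hardy => x 0) h
    simp [one] at this⟩
  rw [← spectrum.zero_notMem_iff ℂ, spectrum.map_polynomial_aeval]
  rintro ⟨z, hz, h0⟩
  exact hp z ((spectrum.norm_le_norm_of_mem hz).trans hT) h0

lemma exists_ev_eq_div {p : ℂ[X]} (hp : ∀ z : ℂ, ‖z‖ ≤ 1 → p.eval z ≠ 0) (x : Hardy) :
    ∃ y : Hardy, aeval shift p y = x ∧ ∀ z : 𝔻, ev z y = (p.eval (z : ℂ))⁻¹ * ev z x := by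
  obtain ⟨u, hu⟩ := isUnit_aeval norm_shift_le hp
  have h1 : aeval shift p ((u⁻¹ : (Hardy →L[ℂ] Hardy)ˣ).val x) = x := by
    rw [← hu, ← mul_apply_eq_comp, Units.mul_inv, one_apply_eq_self]
  refine ⟨_, h1, fun z => ?_⟩
  conv_rhs => rw [← h1, ev_aeval_shift]
  rw [inv_mul_cancel_left₀ (hp z z.norm_lt_one.le)]

/-- A substitute for weak compactness of balls: a diagonal subsequence converges in each
coefficient, the limit stays square-summable, and domination by a geometric series gives convergence
at every point of the disc. -/
lemma exists_subseq_tendsto (x : ℕ → Hardy) {C : ℝ} (hx : ∀ n, ‖x n‖ ≤ C) :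
    ∃ (y : Hardy) (φ : ℕ → ℕ), StrictMono φ ∧
      ∀ z, Tendsto (fun n => ev z (x (φ n))) atTop (𝓝 (ev z y)) := by
  have hb (n k : ℕ) : ‖x n k‖ ≤ C := (lp.norm_apply_le_norm two_ne_zero (x n) k).trans (hx n)
  obtain ⟨f, -, φ, hφ, hf⟩ :=
    (isCompact_univ_pi fun _ : ℕ => isCompact_closedBall (0 : ℂ) C).tendsto_subseq
      (x := fun n => (x n : ℕ → ℂ)) (fun n k _ => by simpa using hb n k)
  have hmem : Memℓp f 2 := by
    refine lp.memℓp_of_tendsto (F := fun n => x (φ n)) (l := atTop) ?_ hf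
    refine isBounded_iff_forall_norm_le.2 ⟨C, ?_⟩
    rintro _ ⟨n, rfl⟩
    exact hx _
  refine ⟨⟨f, hmem⟩, φ, hφ, fun z => ?_⟩
  simp_rw [← fun x => (hasSum_ev z x).tsum_eq]
  refine tendsto_tsum_of_dominated_convergence (bound := fun k => C * ‖(z : ℂ)‖ ^ k)
    ((summable_geometric_of_lt_one (norm_nonneg _) z.norm_lt_one).mul_left C)
    (fun k => ((tendsto_pi_nhds.1 hf k).mul_const _)) (Eventually.of_forall fun n k => ?_)
  rw [norm_mul, norm_pow]
  gcongr
  exact hb _ _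

end Hardy

/-! ### Blaschke factors and convergence of the product. -/

open Hardy
lemma blaschkeFactor_eq (w : ℂ) : ∃ u : ℂ, ‖u‖ = 1 ∧
    ∀ z, blaschkeFactor w z = u * ((w - z) / (1 - conj w * z)) := by
  by_cases hw : w = 0
  · exact ⟨-1, by simp, fun z => by simp [blaschkeFactor, hw]⟩
  · refine ⟨‖w‖ / w, by simp [hw], fun z => by simp [blaschkeFactor, hw]⟩

lemma one_sub_conj_mul_ne_zero (w : 𝔻) {z : ℂ} (hz : ‖z‖ ≤ 1) : 1 - conj (w : ℂ) * z ≠ 0 := by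
  intro h
  have h1 : ‖conj (w : ℂ) * z‖ = 1 := by rw [← sub_eq_zero.1 h]; simp
  rw [norm_mul, RCLike.norm_conj] at h1
  nlinarith [w.norm_lt_one, norm_nonneg (w : ℂ), norm_nonneg z]

/-- The operator form of |w - z| = |1 - conj w · z| on the circle; it uses only that the shift is
isometric. -/
lemma norm_sub_eq_norm_one_sub (w : ℂ) (x : Hardy) :
    ‖w • x - shift x‖ = ‖x - conj w • shift x‖ := by
  refine (sq_eq_sq₀ (norm_nonneg _) (norm_nonneg _)).1 ?_
  rw [@norm_sub_sq ℂ, @norm_sub_sq ℂ, inner_smul_left, inner_smul_right]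
  simp only [norm_smul, norm_shift, RCLike.norm_conj]
  ring

/-- Multiplication by a Blaschke factor is contractive on `H²`. -/
lemma exists_ev_eq_blaschkeFactor_mul (w : 𝔻) (x : Hardy) :
    ∃ y : Hardy, ‖y‖ ≤ ‖x‖ ∧ ∀ z : 𝔻, ev z y = blaschkeFactor w z * ev z x := by
  obtain ⟨u, hu, hb⟩ := blaschkeFactor_eq w
  obtain ⟨y, hy, hy'⟩ := exists_ev_eq_div (p := 1 - C (conj (w : ℂ)) * X)
    (fun z hz => by simpa using one_sub_conj_mul_ne_zero w hz) x
  refine ⟨u • ((w : ℂ) • y - shift y), ?_, fun z => ?_⟩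
  · have : x = y - conj (w : ℂ) • shift y := by
      rw [← hy]
      simp [Algebra.algebraMap_eq_smul_one]
    rw [norm_smul, hu, one_mul, norm_sub_eq_norm_one_sub, ← this]
  · rw [hb, map_smul, map_sub, map_smul, ev_shift, hy']
    simp only [smul_eq_mul, eval_sub, eval_one, eval_mul, eval_C, eval_X]
    ring

lemma exists_ev_eq_prod_mul (Λ : ℕ → 𝔻) (s : Finset ℕ) (x : Hardy) :
    ∃ y : Hardy, ‖y‖ ≤ ‖x‖ ∧ ∀ z : 𝔻, ev z y = (∏ n ∈ s, blaschkeFactor (Λ n) z) * ev z x := by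
  induction s using Finset.induction_on with
  | empty => exact ⟨x, le_rfl, by simp⟩
  | insert a s ha ih =>
    obtain ⟨y, hy, hy'⟩ := ih
    obtain ⟨v, hv, hv'⟩ := exists_ev_eq_blaschkeFactor_mul (Λ a) y
    exact ⟨v, hv.trans hy, fun z => by rw [hv', hy', Finset.prod_insert ha, mul_assoc]⟩

/-- The numerator of 1 - b_w factors as (1 - |w|)(w + |w|z), so the factor |w| in the denominator
cancels and the bound stays uniform as w approaches 0. -/
lemma norm_one_sub_blaschkeFactor_le (w z : 𝔻) :
    ‖1 - blaschkeFactor w z‖ ≤ 2 / (1 - ‖(z : ℂ)‖) * (1 - ‖(w : ℂ)‖ ^ 2) := by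
  have hz := z.norm_lt_one
  have hw1 := w.norm_lt_one
  by_cases hw : (w : ℂ) = 0
  · simp only [blaschkeFactor, hw, if_true, norm_zero]
    have h1 : ‖1 - (z : ℂ)‖ ≤ 2 := (norm_sub_le _ _).trans (by rw [norm_one]; linarith)
    refine h1.trans ?_
    rw [show (1 - (0 : ℝ) ^ 2) = 1 by norm_num, mul_one, le_div_iff₀ (by linarith)]
    nlinarith [norm_nonneg (z : ℂ)]
  · have hne := one_sub_conj_mul_ne_zero w hz.le
    have hc : (‖(w : ℂ)‖ : ℂ) ^ 2 = w * conj (w : ℂ) := by rw [mul_conj']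
    have hE : 1 - blaschkeFactor w z =
        (1 - ‖(w : ℂ)‖) * (w + ‖(w : ℂ)‖ * z) / (w * (1 - conj (w : ℂ) * z)) := by
      simp only [blaschkeFactor, hw, if_false]
      rw [eq_div_iff (mul_ne_zero hw hne), sub_mul, mul_mul_mul_comm, div_mul_cancel₀ _ hw,
        div_mul_cancel₀ _ hne]
      linear_combination (z : ℂ) * hc
    rw [hE, norm_div, norm_mul, norm_mul]
    have hw0 : 0 < ‖(w : ℂ)‖ := norm_pos_iff.2 hw
    have h1 : ‖(1 - ‖(w : ℂ)‖ : ℂ)‖ = 1 - ‖(w : ℂ)‖ := by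
      rw [← ofReal_one, ← ofReal_sub, norm_real, Real.norm_of_nonneg (by linarith)]
    have h2 : ‖(w + ‖(w : ℂ)‖ * z : ℂ)‖ ≤ 2 * ‖(w : ℂ)‖ := by
      refine (norm_add_le _ _).trans ?_
      rw [norm_mul, norm_real, norm_norm]
      nlinarith
    have h3 : 1 - ‖(z : ℂ)‖ ≤ ‖1 - conj (w : ℂ) * z‖ := by
      refine le_trans ?_ (norm_sub_norm_le _ _)
      rw [norm_one, norm_mul, RCLike.norm_conj]
      nlinarith [norm_nonneg (z : ℂ)]
    rw [h1, div_le_iff₀ (by positivity)]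
    calc (1 - ‖(w : ℂ)‖) * ‖(w + ‖(w : ℂ)‖ * z : ℂ)‖ ≤ (1 - ‖(w : ℂ)‖) * (2 * ‖(w : ℂ)‖) := by
          gcongr
      _ ≤ 2 * (1 - ‖(w : ℂ)‖ ^ 2) * ‖(w : ℂ)‖ := by nlinarith
      _ = 2 / (1 - ‖(z : ℂ)‖) * (1 - ‖(w : ℂ)‖ ^ 2) * (‖(w : ℂ)‖ * (1 - ‖(z : ℂ)‖)) := by
          have : 1 - ‖(z : ℂ)‖ ≠ 0 := by linarith
          field_simp
      _ ≤ _ := by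
          have : 0 ≤ 2 / (1 - ‖(z : ℂ)‖) * (1 - ‖(w : ℂ)‖ ^ 2) :=
            mul_nonneg (div_nonneg zero_le_two (by linarith)) (by nlinarith)
          gcongr

lemma multipliable_blaschkeFactor {Λ : ℕ → 𝔻} (h : Summable fun n => 1 - ‖(Λ n : ℂ)‖ ^ 2) (z : 𝔻) :
    Multipliable fun n => blaschkeFactor (Λ n) z := by
  have : Summable fun n => ‖blaschkeFactor (Λ n) z - 1‖ := by
    refine Summable.of_nonneg_of_le (fun _ => norm_nonneg _) (fun n => ?_)
      (h.mul_left (2 / (1 - ‖(z : ℂ)‖)))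
    rw [norm_sub_rev]
    exact norm_one_sub_blaschkeFactor_le _ _
  simpa using multipliable_one_add_of_summable this

/-- Finite products act contractively, so a subsequence of the images of `x` converges pointwise to
an element of H². -/
lemma exists_ev_eq_blaschkeProduct_mul {Λ : ℕ → 𝔻} (h : Summable fun n => 1 - ‖(Λ n : ℂ)‖ ^ 2)
    (x : Hardy) : ∃ y : Hardy, ∀ z : 𝔻, ev z y = blaschkeProduct Λ z * ev z x := by
  choose y hy hy' using fun n : ℕ => exists_ev_eq_prod_mul Λ (Finset.range n) x
  obtain ⟨v, φ, hφ, hv⟩ := exists_subseq_tendsto y hy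
  refine ⟨v, fun z => tendsto_nhds_unique (hv z) ?_⟩
  simp_rw [hy']
  exact ((multipliable_blaschkeFactor h z).tendsto_prod_tprod_nat.comp hφ.tendsto_atTop).mul_const _

/-! ### Taylor data of Blaschke products at a boundary point. -/

/-- Taylor expansion of a Blaschke factor at a point of the circle. -/
lemma exists_taylor_blaschkeFactor (w : 𝔻) {ζ : ℂ} (hζ : ‖ζ‖ = 1) :
    ∃ β g : ℕ → ℂ, ‖β 0‖ = 1 ∧
      (∀ j, ‖β (j + 1)‖ = (1 - ‖(w : ℂ)‖ ^ 2) / ‖ζ - w‖ ^ (j + 2) * ‖(w : ℂ)‖ ^ j) ∧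
      (∀ j, ‖g j‖ = (1 - ‖(w : ℂ)‖ ^ 2) / ‖ζ - w‖ ^ (j + 1) * ‖(w : ℂ)‖ ^ j) ∧
      ∀ j (z : 𝔻), blaschkeFactor w z = ∑ i ∈ Finset.range (j + 1), β i * (z - ζ) ^ i +
        (z - ζ) ^ (j + 1) * (g j * (1 - conj (w : ℂ) * z)⁻¹) := by
  obtain ⟨u, hu, hb⟩ := blaschkeFactor_eq w
  have hD := one_sub_conj_mul_ne_zero w hζ.le
  have hzz : conj ζ * ζ = 1 := by rw [conj_mul', hζ]; simp
  have hDn : ‖1 - conj (w : ℂ) * ζ‖ = ‖ζ - w‖ := by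
    have : 1 - conj (w : ℂ) * ζ = conj (ζ - w) * ζ := by
      rw [map_sub, sub_mul, hzz]
    rw [this, norm_mul, RCLike.norm_conj, hζ, mul_one]
  have hw : 0 ≤ 1 - ‖(w : ℂ)‖ ^ 2 := by nlinarith [w.norm_lt_one, norm_nonneg (w : ℂ)]
  have hwn : ‖(1 - conj (w : ℂ) * w : ℂ)‖ = 1 - ‖(w : ℂ)‖ ^ 2 := by
    rw [conj_mul', ← ofReal_one, ← ofReal_pow, ← ofReal_sub, norm_real, Real.norm_of_nonneg hw]
  set D := 1 - conj (w : ℂ) * ζ with hDdef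
  set g : ℕ → ℂ := fun j => -u * (1 - conj (w : ℂ) * w) / D * (conj (w : ℂ) / D) ^ j with hg
  have hgn (j : ℕ) : ‖g j‖ = (1 - ‖(w : ℂ)‖ ^ 2) / ‖ζ - w‖ ^ (j + 1) * ‖(w : ℂ)‖ ^ j := by
    simp only [hg, norm_mul, norm_div, norm_pow, norm_neg, hu, hDn, hwn, RCLike.norm_conj]
    rw [div_pow, pow_succ]
    ring
  obtain ⟨β, hβ0, hβ⟩ : ∃ β : ℕ → ℂ, β 0 = u * ((w - ζ) / D) ∧ ∀ j, β (j + 1) = g j / D :=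
    ⟨fun j => Nat.casesOn j (u * ((w - ζ) / D)) fun j => g j / D, rfl, fun _ => rfl⟩
  refine ⟨β, g, ?_, ?_, hgn, ?_⟩
  · have h0 : ‖ζ - (w : ℂ)‖ ≠ 0 := by rw [← hDn]; exact norm_ne_zero_iff.2 hD
    rw [hβ0, norm_mul, norm_div, hu, hDn, norm_sub_rev, div_self h0, one_mul]
  · intro j
    rw [hβ, norm_div, hgn, hDn, pow_succ _ (j + 1)]
    ring
  · intro j z
    have hz := one_sub_conj_mul_ne_zero w z.norm_lt_one.le
    induction j with
    | zero =>
      simp only [zero_add, Finset.sum_range_one, pow_zero, pow_one, mul_one, hβ0, hg, hb]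
      set Z := 1 - conj (w : ℂ) * z with hZ
      field_simp
      rw [hDdef, hZ]
      ring
    | succ j ih =>
      rw [ih, Finset.sum_range_succ _ (j + 1), add_assoc, hβ]
      congr 1
      simp only [hg]
      rw [pow_succ (conj (w : ℂ) / D) j, pow_succ _ (j + 1)]
      -- One more step of the geometric expansion of the Szegő kernel about ζ.
      have : (1 - conj (w : ℂ) * z)⁻¹ = 1 / D + (z - ζ) * (conj (w : ℂ) / D) * (1 - conj (w : ℂ) * z)⁻¹ := by
        field_simp
        rw [hDdef]
        ring
      conv_lhs => rw [this]
      ring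

/-- Distances from ζ to points of the disc are at most 2, so every lower negative power is absorbed
by the highest one. -/
lemma one_div_pow_le_of_le_two {δ : ℝ} (h0 : 0 < δ) (h2 : δ ≤ 2) {i n : ℕ} (hin : i ≤ n) :
    1 / δ ^ i ≤ 2 ^ n / δ ^ n := by
  rw [div_le_div_iff₀ (by positivity) (by positivity), one_mul]
  obtain ⟨k, rfl⟩ := Nat.exists_eq_add_of_le hin
  rw [pow_add, pow_add, mul_comm]
  have : δ ^ k ≤ 2 ^ k := by gcongr
  have h1 : (1 : ℝ) ≤ 2 ^ i := one_le_pow₀ one_le_two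
  calc δ ^ k * δ ^ i ≤ 2 ^ k * δ ^ i := by gcongr
    _ ≤ 2 ^ i * 2 ^ k * δ ^ i := by
      gcongr
      exact le_mul_of_one_le_left (by positivity) h1

/-- The effect on Taylor data at `ζ` of multiplication by a Blaschke factor. -/
lemma exists_taylor_blaschkeFactor_mul (w : 𝔻) {ζ : ℂ} (hζ : ‖ζ‖ = 1) {N : ℕ} (hN : 1 ≤ N)
    {G : ℂ → ℂ} {t : ℕ → ℂ} {h : Hardy}
    (hG : ∀ z : 𝔻, G z = ∑ i ∈ Finset.range N, t i * (z - ζ) ^ i + (z - ζ) ^ N * ev z h) :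
    ∃ (t' : ℕ → ℂ) (h' : Hardy),
      (∀ z : 𝔻, blaschkeFactor w z * G z =
        ∑ i ∈ Finset.range N, t' i * (z - ζ) ^ i + (z - ζ) ^ N * ev z h') ∧
      ‖t' 0‖ = ‖t 0‖ ∧
      ∑ i ∈ Finset.range N, ‖t' i‖ ≤ (∑ i ∈ Finset.range N, ‖t i‖) *
        (1 + N * 4 ^ N * ((1 - ‖(w : ℂ)‖ ^ 2) / ‖ζ - w‖ ^ (2 * N))) ∧
      ‖h'‖ ^ 2 ≤ ‖h‖ ^ 2 + (∑ i ∈ Finset.range N, ‖t i‖) ^ 2 *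
        (4 ^ N * ((1 - ‖(w : ℂ)‖ ^ 2) / ‖ζ - w‖ ^ (2 * N))) := by
  obtain ⟨β, g, hβ0, hβ, hg, hb⟩ := exists_taylor_blaschkeFactor w hζ
  obtain ⟨y, hy, hy'⟩ := exists_ev_eq_blaschkeFactor_mul w h
  have hw1 := w.norm_lt_one
  have hw : 0 < 1 - ‖(w : ℂ)‖ ^ 2 := by nlinarith [norm_nonneg (w : ℂ)]
  have hδ2 : ‖ζ - (w : ℂ)‖ ≤ 2 := (norm_sub_le _ _).trans (by linarith)
  have hδ0 : 0 < ‖ζ - (w : ℂ)‖ := by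
    have := norm_sub_norm_le ζ (w : ℂ)
    linarith
  set δ := ‖ζ - (w : ℂ)‖
  have hwj (j : ℕ) : ‖(w : ℂ)‖ ^ j ≤ 1 := pow_le_one₀ (norm_nonneg _) hw1.le
  have hq {k j n : ℕ} (hk : k ≤ n) :
      (1 - ‖(w : ℂ)‖ ^ 2) / δ ^ k * ‖(w : ℂ)‖ ^ j ≤ (1 - ‖(w : ℂ)‖ ^ 2) * (2 ^ n / δ ^ n) := by
    calc _ ≤ (1 - ‖(w : ℂ)‖ ^ 2) / δ ^ k * 1 :=
          mul_le_mul_of_nonneg_left (hwj _) (by positivity)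
      _ = (1 - ‖(w : ℂ)‖ ^ 2) * (1 / δ ^ k) := by ring
      _ ≤ _ := mul_le_mul_of_nonneg_left (one_div_pow_le_of_le_two hδ0 hδ2 hk) hw.le
  set T := ∑ i ∈ Finset.range N, ‖t i‖ with hT
  have hT0 : 0 ≤ T := Finset.sum_nonneg fun _ _ => norm_nonneg _
  set c := ∑ j ∈ Finset.range N, t j * g (N - 1 - j) with hc
  have hcn : ‖c‖ ≤ T * ((1 - ‖(w : ℂ)‖ ^ 2) * (2 ^ N / δ ^ N)) := by
    rw [hT, Finset.sum_mul]
    refine (norm_sum_le _ _).trans (Finset.sum_le_sum fun j hj => ?_)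
    rw [norm_mul, hg]
    exact mul_le_mul_of_nonneg_left (hq (by omega)) (norm_nonneg _)
  -- The new coefficients are the Cauchy product cut at degree N. The term t j (z - ζ)^j needs the
  -- factor only up to degree N - 1 - j; what is left over is a multiple of the Szegő kernel, and
  -- these multiples add up to `c`.
  refine ⟨fun i => ∑ k ∈ Finset.range (i + 1), t k * β (i - k), y + c • szego w, ?_, ?_, ?_, ?_⟩
  · intro z
    rw [hG, mul_add, Finset.mul_sum]
    have h1 : ∀ j ∈ Finset.range N, blaschkeFactor w z * (t j * (z - ζ) ^ j) =
        ∑ k ∈ Finset.range (N - j), t j * β k * (z - ζ) ^ (j + k) +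
          (z - ζ) ^ N * (t j * g (N - 1 - j) * (1 - conj (w : ℂ) * z)⁻¹) := by
      intro j hj
      have hj' := Finset.mem_range.1 hj
      rw [hb (N - 1 - j) z, show N - 1 - j + 1 = N - j by omega, add_mul, Finset.sum_mul]
      congr 1
      · exact Finset.sum_congr rfl fun k _ => by ring
      · have : (z - ζ : ℂ) ^ N = (z - ζ) ^ (N - j) * (z - ζ) ^ j := by
          rw [← pow_add]; congr 1; omega
        rw [this]; ring
    rw [Finset.sum_congr rfl h1, Finset.sum_add_distrib,
      ← Finset.sum_range_diag_flip N fun j k => t j * β k * (z - ζ : ℂ) ^ (j + k),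
      ← Finset.mul_sum, ← Finset.sum_mul, map_add, map_smul, ev_szego, hy', smul_eq_mul, ← hc]
    have h2 : ∀ m ∈ Finset.range N, ∑ k ∈ Finset.range (m + 1), t k * β (m - k) *
        (z - ζ : ℂ) ^ (k + (m - k)) = (∑ k ∈ Finset.range (m + 1), t k * β (m - k)) * (z - ζ) ^ m := by
      intro m _
      rw [Finset.sum_mul]
      refine Finset.sum_congr rfl fun k hk => ?_
      rw [Nat.add_sub_cancel' (Finset.mem_range_succ_iff.1 hk)]
    rw [Finset.sum_congr rfl h2]
    ring
  · simp [hβ0]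
  · have hB : ∑ k ∈ Finset.range N, ‖β k‖ ≤
        1 + N * 4 ^ N * ((1 - ‖(w : ℂ)‖ ^ 2) / δ ^ (2 * N)) := by
      obtain ⟨M, rfl⟩ := Nat.exists_eq_add_of_le' hN
      rw [Finset.sum_range_succ', hβ0, add_comm]
      gcongr
      have : ∀ k ∈ Finset.range M, ‖β (k + 1)‖ ≤
          4 ^ (M + 1) * ((1 - ‖(w : ℂ)‖ ^ 2) / δ ^ (2 * (M + 1))) := by
        intro k hk
        have hk' := Finset.mem_range.1 hk
        rw [hβ]
        calc _ ≤ (1 - ‖(w : ℂ)‖ ^ 2) * (2 ^ (2 * (M + 1)) / δ ^ (2 * (M + 1))) := hq (by omega)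
          _ = _ := by rw [pow_mul]; norm_num; ring
      refine (Finset.sum_le_sum this).trans ?_
      rw [Finset.sum_const, Finset.card_range, nsmul_eq_mul, mul_assoc]
      gcongr
      omega
    calc ∑ i ∈ Finset.range N, ‖∑ k ∈ Finset.range (i + 1), t k * β (i - k)‖
        ≤ ∑ i ∈ Finset.range N, ∑ k ∈ Finset.range (i + 1), ‖t k‖ * ‖β (i - k)‖ :=
          Finset.sum_le_sum fun i _ => (norm_sum_le _ _).trans (by simp)
      _ = ∑ m ∈ Finset.range N, ∑ k ∈ Finset.range (N - m), ‖t m‖ * ‖β k‖ :=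
          Finset.sum_range_diag_flip N fun j k => ‖t j‖ * ‖β k‖
      _ ≤ ∑ m ∈ Finset.range N, ∑ k ∈ Finset.range N, ‖t m‖ * ‖β k‖ :=
          Finset.sum_le_sum fun m _ => Finset.sum_le_sum_of_subset_of_nonneg
            (Finset.range_mono (Nat.sub_le _ _)) fun _ _ _ => by positivity
      _ = T * ∑ k ∈ Finset.range N, ‖β k‖ := by rw [hT, Finset.sum_mul_sum]
      _ ≤ _ := by gcongr
  -- Orthogonality holds because `y` carries the Blaschke factor, which vanishes at w.
  · have horth : inner ℂ y (c • szego w) = 0 := by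
      rw [inner_smul_right, ← inner_conj_symm, ← ev_eq_inner, hy']
      obtain ⟨u, -, hu⟩ := blaschkeFactor_eq w
      simp [hu]
    rw [@norm_add_sq ℂ, horth, map_zero, mul_zero, add_zero, norm_smul, mul_pow, norm_szego_sq]
    refine add_le_add (pow_le_pow_left₀ (norm_nonneg _) hy 2) ?_
    -- The bound on ‖c‖² contains (1 - |w|²)²; the norm of the Szegő kernel takes back one factor,
    -- leaving exactly the summable quantity.
    calc ‖c‖ ^ 2 * (1 - ‖(w : ℂ)‖ ^ 2)⁻¹
        ≤ (T * ((1 - ‖(w : ℂ)‖ ^ 2) * (2 ^ N / δ ^ N))) ^ 2 * (1 - ‖(w : ℂ)‖ ^ 2)⁻¹ := by gcongr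
      _ = T ^ 2 * (4 ^ N * ((1 - ‖(w : ℂ)‖ ^ 2) / δ ^ (2 * N))) := by
          rw [show (4 : ℝ) = 2 ^ 2 by norm_num, ← pow_mul, mul_comm 2 N, pow_mul, pow_mul]
          field_simp

/-- Taylor data at `ζ` of finite Blaschke products, with uniform bounds. -/
lemma exists_taylor_prod_blaschkeFactor (Λ : ℕ → 𝔻) {ζ : ℂ} (hζ : ‖ζ‖ = 1) {N : ℕ} (hN : 1 ≤ N)
    (s : Finset ℕ) :
    ∃ (t : ℕ → ℂ) (h : Hardy),
      (∀ z : 𝔻, ∏ n ∈ s, blaschkeFactor (Λ n) z =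
        ∑ i ∈ Finset.range N, t i * (z - ζ) ^ i + (z - ζ) ^ N * ev z h) ∧
      ‖t 0‖ = 1 ∧
      ∑ i ∈ Finset.range N, ‖t i‖ ≤ Real.exp (N * 4 ^ N *
        ∑ n ∈ s, (1 - ‖(Λ n : ℂ)‖ ^ 2) / ‖ζ - Λ n‖ ^ (2 * N)) ∧
      ‖h‖ ^ 2 ≤ Real.exp (N * 4 ^ N *
        ∑ n ∈ s, (1 - ‖(Λ n : ℂ)‖ ^ 2) / ‖ζ - Λ n‖ ^ (2 * N)) ^ 2 *
        (4 ^ N * ∑ n ∈ s, (1 - ‖(Λ n : ℂ)‖ ^ 2) / ‖ζ - Λ n‖ ^ (2 * N)) := by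
  induction s using Finset.induction_on with
  | empty =>
    obtain ⟨M, rfl⟩ := Nat.exists_eq_add_of_le' hN
    exact ⟨fun i => if i = 0 then 1 else 0, 0, by simp, by simp, by simp [apply_ite], by simp⟩
  | insert a s ha ih =>
    obtain ⟨t, h, h1, h2, h3, h4⟩ := ih
    obtain ⟨t', h', h1', h2', h3', h4'⟩ := exists_taylor_blaschkeFactor_mul (Λ a) hζ hN
      (G := fun z => ∏ n ∈ s, blaschkeFactor (Λ n) z) h1
    have hε : 0 ≤ (1 - ‖(Λ a : ℂ)‖ ^ 2) / ‖ζ - Λ a‖ ^ (2 * N) :=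
      div_nonneg (by nlinarith [(Λ a).norm_lt_one, norm_nonneg (Λ a : ℂ)]) (by positivity)
    have hσ : 0 ≤ ∑ n ∈ s, (1 - ‖(Λ n : ℂ)‖ ^ 2) / ‖ζ - Λ n‖ ^ (2 * N) :=
      Finset.sum_nonneg fun n _ =>
        div_nonneg (by nlinarith [(Λ n).norm_lt_one, norm_nonneg (Λ n : ℂ)]) (by positivity)
    simp only [Finset.prod_insert ha, Finset.sum_insert ha]
    set ε := (1 - ‖(Λ a : ℂ)‖ ^ 2) / ‖ζ - Λ a‖ ^ (2 * N)
    set σ := ∑ n ∈ s, (1 - ‖(Λ n : ℂ)‖ ^ 2) / ‖ζ - Λ n‖ ^ (2 * N)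
    refine ⟨t', h', h1', h2'.trans h2, h3'.trans ?_, h4'.trans ?_⟩
    · rw [mul_add _ ε, add_comm (_ * ε), Real.exp_add]
      refine mul_le_mul h3 ?_ (by positivity) (Real.exp_pos _).le
      rw [add_comm]
      exact Real.add_one_le_exp _
    · calc _ ≤ Real.exp (N * 4 ^ N * σ) ^ 2 * (4 ^ N * σ) +
            Real.exp (N * 4 ^ N * σ) ^ 2 * (4 ^ N * ε) := by gcongr
        _ = Real.exp (N * 4 ^ N * σ) ^ 2 * (4 ^ N * (ε + σ)) := by ring
        _ ≤ _ := by
          gcongr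
          linarith

lemma SummableAt.summable_one_sub {Λ : ℕ → 𝔻} {ζ : ℂ} (hζ : ‖ζ‖ = 1) {N : ℕ}
    (h : SummableAt Λ ζ N) : Summable fun n => 1 - ‖(Λ n : ℂ)‖ ^ 2 := by
  refine Summable.of_nonneg_of_le
    (fun n => by nlinarith [(Λ n).norm_lt_one, norm_nonneg (Λ n : ℂ)]) (fun n => ?_)
    (h.mul_left (2 ^ (2 * N)))
  have h1 := (Λ n).norm_lt_one
  have hδ2 : ‖ζ - (Λ n : ℂ)‖ ≤ 2 := (norm_sub_le _ _).trans (by linarith)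
  have hδ0 : 0 < ‖ζ - (Λ n : ℂ)‖ := by linarith [norm_sub_norm_le ζ (Λ n : ℂ)]
  have hw : 0 ≤ 1 - ‖(Λ n : ℂ)‖ ^ 2 := by nlinarith [norm_nonneg (Λ n : ℂ)]
  have := one_div_pow_le_of_le_two hδ0 hδ2 (Nat.zero_le (2 * N))
  rw [pow_zero, div_one] at this
  calc _ ≤ (2 ^ (2 * N) / ‖ζ - (Λ n : ℂ)‖ ^ (2 * N)) * (1 - ‖(Λ n : ℂ)‖ ^ 2) :=
        le_mul_of_one_le_left hw this
    _ = _ := by ring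

/-- A Blaschke product is, up to `(z - ζ)^N H²`, a polynomial of degree less than `N`. -/
lemma SummableAt.exists_taylor {Λ : ℕ → 𝔻} {ζ : ℂ} (hζ : ‖ζ‖ = 1) {N : ℕ} (hN : 1 ≤ N)
    (hs : SummableAt Λ ζ N) :
    ∃ p ∈ Polynomial.degreeLT ℂ N, ∃ h : Hardy, ‖p.eval ζ‖ = 1 ∧
      ∀ z : 𝔻, blaschkeProduct Λ z = p.eval (z : ℂ) + (z - ζ) ^ N * ev z h := by
  choose t h h1 h2 h3 h4 using fun n : ℕ =>
    exists_taylor_prod_blaschkeFactor Λ hζ hN (Finset.range n)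
  have hσ (n : ℕ) : ∑ k ∈ Finset.range n, (1 - ‖(Λ k : ℂ)‖ ^ 2) / ‖ζ - Λ k‖ ^ (2 * N) ≤
      ∑' k, (1 - ‖(Λ k : ℂ)‖ ^ 2) / ‖ζ - Λ k‖ ^ (2 * N) :=
    hs.sum_le_tsum _ fun k _ =>
      div_nonneg (by nlinarith [(Λ k).norm_lt_one, norm_nonneg (Λ k : ℂ)]) (by positivity)
  set σ := ∑' k, (1 - ‖(Λ k : ℂ)‖ ^ 2) / ‖ζ - Λ k‖ ^ (2 * N)
  have hE (n : ℕ) : Real.exp (N * 4 ^ N * ∑ k ∈ Finset.range n,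
      (1 - ‖(Λ k : ℂ)‖ ^ 2) / ‖ζ - Λ k‖ ^ (2 * N)) ≤ Real.exp (N * 4 ^ N * σ) := by
    gcongr
    exact hσ n
  have hh (n : ℕ) : ‖h n‖ ≤ √(Real.exp (N * 4 ^ N * σ) ^ 2 * (4 ^ N * σ)) := by
    refine Real.le_sqrt_of_sq_le ((h4 n).trans ?_)
    have h0 : 0 ≤ ∑ k ∈ Finset.range n, (1 - ‖(Λ k : ℂ)‖ ^ 2) / ‖ζ - Λ k‖ ^ (2 * N) :=
      Finset.sum_nonneg fun k _ =>
        div_nonneg (by nlinarith [(Λ k).norm_lt_one, norm_nonneg (Λ k : ℂ)]) (by positivity)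
    have := hE n
    have := hσ n
    gcongr
  obtain ⟨y, φ, hφ, hy⟩ := exists_subseq_tendsto h hh
  -- A second extraction makes the N Taylor coefficients converge as well; they stay in a fixed
  -- ball.
  obtain ⟨τ, -, ψ, hψ, hτ⟩ := (isCompact_closedBall (0 : Fin N → ℂ)
    (Real.exp (N * 4 ^ N * σ))).tendsto_subseq (x := fun n => fun i : Fin N => t (φ n) i) (by
      intro n
      rw [mem_closedBall_zero_iff, pi_norm_le_iff_of_nonneg (Real.exp_pos _).le]
      intro i
      refine le_trans ?_ ((h3 (φ n)).trans (hE _))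
      exact Finset.single_le_sum (f := fun i => ‖t (φ n) i‖) (fun _ _ => norm_nonneg _)
        (Finset.mem_range.2 i.2))
  have hτ' (i : Fin N) : Tendsto (fun n => t (φ (ψ n)) i) atTop (𝓝 (τ i)) :=
    tendsto_pi_nhds.1 hτ i
  have hev (z : ℂ) : (∑ i : Fin N, C (τ i) * (X - C ζ) ^ (i : ℕ)).eval z =
      ∑ i : Fin N, τ i * (z - ζ) ^ (i : ℕ) := by
    simp [eval_finsetSum]
  refine ⟨∑ i : Fin N, C (τ i) * (X - C ζ) ^ (i : ℕ), ?_, y, ?_, fun z => ?_⟩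
  · refine Submodule.sum_mem _ fun i _ => ?_
    rw [Polynomial.mem_degreeLT]
    refine (degree_mul_le _ _).trans_lt ?_
    rw [degree_pow, degree_X_sub_C, nsmul_one]
    calc _ ≤ (0 : WithBot ℕ) + (i : ℕ) := by gcongr; exact degree_C_le
      _ < N := by rw [zero_add]; exact_mod_cast i.2
  · rw [hev, Finset.sum_eq_single (⟨0, hN⟩ : Fin N)]
    · have := (hτ' ⟨0, hN⟩).norm
      simp only [h2] at this
      simpa using tendsto_nhds_unique this tendsto_const_nhds
    · intro i _ hi
      have : (i : ℕ) ≠ 0 := fun h => hi (Fin.ext h)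
      simp [this]
    · simp
  · rw [hev]
    have hB := ((multipliable_blaschkeFactor (hs.summable_one_sub hζ) z).tendsto_prod_tprod_nat.comp
      hφ.tendsto_atTop).comp hψ.tendsto_atTop
    refine tendsto_nhds_unique hB ?_
    have : ∀ n, ((fun n => ∏ i ∈ Finset.range n, blaschkeFactor (Λ i) z) ∘ φ ∘ ψ) n =
        ∑ i : Fin N, t (φ (ψ n)) i * (z - ζ) ^ (i : ℕ) + (z - ζ) ^ N * ev z (h (φ (ψ n))) := by
      intro n
      rw [Function.comp_apply, h1, Finset.sum_range]
      rfl
    refine Tendsto.congr (fun n => (this n).symm) ?_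
    exact (tendsto_finsetSum _ fun i _ => (hτ' i).mul_const _).add
      (((hy z).comp hψ.tendsto_atTop).const_mul _)

/-! ### Radial limit and local Dirichlet integral. -/

lemma SummableAt.hasUnimodularRadialLimit {Λ : ℕ → 𝔻} {ζ : ℂ} (hζ : ‖ζ‖ = 1) {N : ℕ} (hN : 1 ≤ N)
    (hs : SummableAt Λ ζ N) : HasUnimodularRadialLimit (blaschkeProduct Λ) ζ := by
  obtain ⟨p, -, h, hp, hB⟩ := hs.exists_taylor hζ hN
  refine ⟨p.eval ζ, ?_, hp⟩
  have h1 : Tendsto (fun r : ℝ => p.eval (r * ζ)) (𝓝[<] 1) (𝓝 (p.eval ζ)) := by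
    have : Continuous fun r : ℝ => p.eval (r * ζ) := by fun_prop
    simpa using (this.tendsto 1).mono_left nhdsWithin_le_nhds
  have hI : ∀ᶠ r : ℝ in 𝓝[<] 1, r ∈ Set.Ioo (0 : ℝ) 1 := Ioo_mem_nhdsLT zero_lt_one
  -- An H² function grows at most like (1 - r²)^(-1/2), and the factor (1 - r)^N with N ≥ 1
  -- outweighs this.
  have h2 : Tendsto (fun r : ℝ => blaschkeProduct Λ (r * ζ) - p.eval (r * ζ)) (𝓝[<] 1) (𝓝 0) := by
    have hlim : Tendsto (fun r : ℝ => √((1 - r) * ‖h‖ ^ 2)) (𝓝[<] 1) (𝓝 0) := by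
      have : Continuous fun r : ℝ => √((1 - r) * ‖h‖ ^ 2) := by fun_prop
      simpa using (this.tendsto 1).mono_left nhdsWithin_le_nhds
    refine squeeze_zero_norm' ?_ hlim
    filter_upwards [hI] with r hr
    have hrn : ‖(r * ζ : ℂ)‖ = r := by rw [norm_mul, hζ, norm_real, Real.norm_of_nonneg hr.1.le, mul_one]
    obtain ⟨z, hz⟩ : ∃ z : 𝔻, (z : ℂ) = r * ζ := ⟨UnitDisc.mk (r * ζ) (by rw [hrn]; exact hr.2), rfl⟩
    have hB' := hB z
    have he := norm_ev_le z h
    rw [hz] at hB' he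
    rw [hB', add_sub_cancel_left]
    refine Real.le_sqrt_of_sq_le ?_
    have h3 : ‖(r * ζ - ζ : ℂ)‖ = 1 - r := by
      rw [show (r * ζ - ζ : ℂ) = ((r - 1 : ℝ) : ℂ) * ζ by push_cast; ring, norm_mul, hζ, norm_real,
        mul_one, Real.norm_of_nonpos (by linarith [hr.2]), neg_sub]
    rw [norm_mul, norm_pow, h3, mul_pow]
    rw [hrn] at he
    have h4 : (1 - r) ^ N ≤ 1 - r := by
      simpa using pow_le_pow_of_le_one (by linarith [hr.2]) (by linarith [hr.1]) hN
    have hr1 : 0 < 1 - r := by linarith [hr.2]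
    calc _ ≤ (1 - r) ^ 2 * (‖h‖ ^ 2 / (1 - r ^ 2)) := by gcongr
      _ = (1 - r) * ((1 - r) / (1 - r ^ 2)) * ‖h‖ ^ 2 := by ring
      _ ≤ (1 - r) * 1 * ‖h‖ ^ 2 := by
        gcongr
        rw [div_le_one (by nlinarith [hr.1])]
        nlinarith [hr.1]
      _ = _ := by ring
  simpa using h2.add h1

lemma integral_exp_sub_mul_I (k l : ℕ) :
    ∫ θ in (0 : ℝ)..2 * Real.pi, cexp (θ * I) ^ k * conj (cexp (θ * I) ^ l) =
      if k = l then (2 * Real.pi : ℂ) else 0 := by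
  have h (θ : ℝ) : cexp (θ * I) ^ k * conj (cexp (θ * I) ^ l) = cexp (((k : ℂ) - l) * I * θ) := by
    rw [map_pow, ← exp_conj, ← exp_nat_mul, ← exp_nat_mul, ← exp_add]
    congr 1
    simp only [map_mul, conj_ofReal, conj_I]
    ring
  simp_rw [h]
  split_ifs with hkl
  · simp [hkl]
  · have hc : ((k : ℂ) - l) * I ≠ 0 :=
      mul_ne_zero (sub_ne_zero.2 (by exact_mod_cast hkl)) I_ne_zero
    rw [integral_exp_mul_complex hc, ofReal_zero, mul_zero, exp_zero]
    have : cexp (((k : ℂ) - l) * I * (2 * Real.pi : ℝ)) = 1 := by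
      rw [Complex.exp_eq_one_iff]
      exact ⟨(k : ℤ) - l, by push_cast; ring⟩
    rw [this, sub_self, zero_div]

lemma lintegral_norm_sq_sum_exp (c : ℕ → ℂ) (n : ℕ) :
    ∫⁻ θ in Set.Ioc (0 : ℝ) (2 * Real.pi),
      ‖∑ k ∈ Finset.range n, c k * cexp (θ * I) ^ k‖ₑ ^ 2 =
      ENNReal.ofReal (2 * Real.pi * ∑ k ∈ Finset.range n, ‖c k‖ ^ 2) := by
  have hint : ∫ θ in (0 : ℝ)..2 * Real.pi, ‖∑ k ∈ Finset.range n, c k * cexp (θ * I) ^ k‖ ^ 2 =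
      2 * Real.pi * ∑ k ∈ Finset.range n, ‖c k‖ ^ 2 := by
    apply ofReal_injective
    rw [← intervalIntegral.integral_ofReal]
    have h (θ : ℝ) : ((‖∑ k ∈ Finset.range n, c k * cexp (θ * I) ^ k‖ ^ 2 : ℝ) : ℂ) =
        ∑ k ∈ Finset.range n, ∑ l ∈ Finset.range n,
          c k * conj (c l) * (cexp (θ * I) ^ k * conj (cexp (θ * I) ^ l)) := by
      rw [ofReal_pow, ← mul_conj', map_sum, Finset.sum_mul_sum]
      refine Finset.sum_congr rfl fun k _ => Finset.sum_congr rfl fun l _ => ?_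
      rw [map_mul]
      ring
    simp_rw [h]
    rw [intervalIntegral.integral_finsetSum fun k _ =>
      Continuous.intervalIntegrable (by fun_prop) _ _]
    have h2 : ∀ k ∈ Finset.range n, ∫ θ in (0 : ℝ)..2 * Real.pi, ∑ l ∈ Finset.range n,
        c k * conj (c l) * (cexp (θ * I) ^ k * conj (cexp (θ * I) ^ l)) =
        2 * Real.pi * (‖c k‖ : ℂ) ^ 2 := by
      intro k hk
      rw [intervalIntegral.integral_finsetSum fun k _ =>
        Continuous.intervalIntegrable (by fun_prop) _ _]
      simp_rw [intervalIntegral.integral_const_mul, integral_exp_sub_mul_I]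
      simp only [mul_ite, mul_zero, Finset.sum_ite_eq, hk, if_true, mul_conj']
      ring
    rw [Finset.sum_congr rfl h2, ← Finset.mul_sum]
    push_cast
    rfl
  have hcont : Continuous fun θ : ℝ => ‖∑ k ∈ Finset.range n, c k * cexp (θ * I) ^ k‖ ^ 2 := by
    fun_prop
  rw [← hint, intervalIntegral.integral_of_le Real.two_pi_pos.le,
    ofReal_integral_eq_lintegral_ofReal
      ((hcont.intervalIntegrable 0 (2 * Real.pi)).1)
      (Eventually.of_forall fun _ => by positivity)]
  refine lintegral_congr fun θ => ?_
  rw [ENNReal.ofReal_pow (norm_nonneg _), ofReal_norm]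

/-- Parseval for partial sums followed by Fatou; an upper bound suffices for finiteness. -/
lemma hardyNormSq_le {f : ℂ → ℂ} {h : Hardy} (hf : ∀ z : 𝔻, f z = ev z h) :
    hardyNormSq f ≤ ENNReal.ofReal (‖h‖ ^ 2) := by
  refine iSup₂_le fun r hr => ?_
  have hpi : ENNReal.ofReal (2 * Real.pi) ≠ 0 := by simp [Real.pi_pos]
  rw [ENNReal.inv_mul_le_iff hpi ENNReal.ofReal_ne_top,
    ← ENNReal.ofReal_mul Real.two_pi_pos.le]
  have hr' : ‖(r : ℂ)‖ = r := by rw [norm_real, Real.norm_of_nonneg hr.1.le]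
  have hlim (θ : ℝ) : Tendsto (fun n => ∑ k ∈ Finset.range n, (h k * r ^ k) * cexp (θ * I) ^ k)
      atTop (𝓝 (f (circleMap 0 r θ))) := by
    obtain ⟨z, hz⟩ : ∃ z : 𝔻, (z : ℂ) = circleMap 0 r θ :=
      ⟨UnitDisc.mk (circleMap 0 r θ) (by simpa [abs_of_pos hr.1] using hr.2), rfl⟩
    have := (hasSum_ev z h).tendsto_sum_nat
    rw [← hf, hz] at this
    refine this.congr fun n => Finset.sum_congr rfl fun k _ => ?_
    simp only [circleMap, zero_add, mul_pow]
    ring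
  calc ∫⁻ θ in Set.Ioc (0 : ℝ) (2 * Real.pi), ‖f (circleMap 0 r θ)‖ₑ ^ 2
      = ∫⁻ θ in Set.Ioc (0 : ℝ) (2 * Real.pi), liminf (fun n =>
          ‖∑ k ∈ Finset.range n, (h k * r ^ k) * cexp (θ * I) ^ k‖ₑ ^ 2) atTop := by
        refine lintegral_congr fun θ => ?_
        exact (((continuous_enorm.tendsto _).comp (hlim θ)).ennrpow_const 2 |>.congr
          (fun n => by simp) |>.liminf_eq.trans (by simp)).symm
    _ ≤ liminf (fun n => ∫⁻ θ in Set.Ioc (0 : ℝ) (2 * Real.pi),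
          ‖∑ k ∈ Finset.range n, (h k * r ^ k) * cexp (θ * I) ^ k‖ₑ ^ 2) atTop :=
        lintegral_liminf_le fun n => by fun_prop
    _ ≤ ENNReal.ofReal (2 * Real.pi * ‖h‖ ^ 2) := by
        refine liminf_le_of_le (by isBoundedDefault) fun b hb => ?_
        obtain ⟨n, hn⟩ := hb.exists
        refine hn.trans ?_
        rw [lintegral_norm_sq_sum_exp]
        gcongr
        rw [norm_sq_eq]
        refine le_trans (Finset.sum_le_sum fun k _ => ?_)
          (h.summable_sq.sum_le_tsum (Finset.range n) fun _ _ => by positivity)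
        rw [norm_mul, norm_pow, hr', mul_pow]
        exact mul_le_of_le_one_right (by positivity)
          (pow_le_one₀ (by have := hr.1; positivity) (pow_le_one₀ hr.1.le hr.2.le))

lemma SummableAt.localDirichletIntegral_lt_top {Λ : ℕ → 𝔻} {ζ : ℂ} (hζ : ‖ζ‖ = 1) {N : ℕ}
    (hN : 1 ≤ N) (hs : SummableAt Λ ζ N) :
    localDirichletIntegral N ζ (blaschkeProduct Λ) < ⊤ := by
  obtain ⟨p, hp, h, -, hB⟩ := hs.exists_taylor hζ hN
  refine lt_of_le_of_lt (iInf₂_le p hp) (lt_of_le_of_lt (hardyNormSq_le (h := h) fun z => ?_)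
    ENNReal.ofReal_lt_top)
  have hz : (z - ζ : ℂ) ≠ 0 := by
    rw [sub_ne_zero]
    rintro rfl
    exact z.norm_lt_one.ne hζ
  rw [hB, add_sub_cancel_left, mul_div_cancel_left₀ _ (pow_ne_zero _ hz)]

/-! ### Toeplitz operators with polynomial symbols and their ranges. -/

namespace Hardy

lemma adjoint_aeval_shift (p : ℂ[X]) :
    (aeval shift p).adjoint = aeval back (p.map (starRingEnd ℂ)) := by
  induction p using Polynomial.induction_on' with
  | add p q hp hq => simp only [map_add, Polynomial.map_add, hp, hq]
  | monomial n a =>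
    have h : (shift ^ n).adjoint = back ^ n := by
      rw [← ContinuousLinearMap.star_eq_adjoint, star_pow]; rfl
    simp only [aeval_monomial, map_monomial, Algebra.algebraMap_eq_smul_one, smul_mul_assoc,
      one_mul, map_smulₛₗ, h]

lemma back_pow_mul_shift_pow (n : ℕ) : back ^ n * shift ^ n = 1 := by
  induction n with
  | zero => simp
  | succ n ih =>
    rw [pow_succ, pow_succ', mul_assoc, ← mul_assoc back, back_mul_shift, one_mul, ih]

lemma aeval_back_mul_shift_pow {f : ℂ[X]} {n : ℕ} (hf : f.natDegree ≤ n) :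
    aeval back f * shift ^ n = aeval shift (f.reflect n) := by
  refine Polynomial.induction_with_natDegree_le
    (fun f => aeval back f * shift ^ n = aeval shift (f.reflect n)) n (by simp) ?_ ?_ f hf
  · intro k a _ hk
    rw [reflect_C_mul_X_pow, revAt_le hk]
    obtain ⟨m, rfl⟩ := Nat.exists_eq_add_of_le hk
    simp only [map_mul, aeval_C, map_pow, aeval_X, Nat.add_sub_cancel_left]
    rw [pow_add, mul_assoc, ← mul_assoc (back ^ k), back_pow_mul_shift_pow, one_mul]
  · intro f g _ _ hf hg
    simp only [map_add, add_mul, hf, hg, reflect_add]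

/-- Co-analytic times analytic is reduced to one analytic polynomial behind a power of `back`, so
operator identities become polynomial identities. -/
lemma aeval_back_mul_aeval_shift {f : ℂ[X]} {n : ℕ} (hf : f.natDegree ≤ n) (g : ℂ[X]) :
    aeval back f * aeval shift g = back ^ n * aeval shift (f.reflect n * g) := by
  have h1 : aeval shift g * shift ^ n = shift ^ n * aeval shift g := by
    rw [← aeval_X_pow (R := ℂ) shift, ← map_mul, ← map_mul, mul_comm]
  have h2 : aeval back f * back ^ n = back ^ n * aeval back f := by
    rw [← aeval_X_pow (R := ℂ) back, ← map_mul, ← map_mul, mul_comm]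
  calc aeval back f * aeval shift g
      = aeval back f * ((back ^ n * shift ^ n) * aeval shift g) := by
        rw [back_pow_mul_shift_pow, one_mul]
    _ = aeval back f * back ^ n * (shift ^ n * aeval shift g) := by simp only [mul_assoc]
    _ = _ := by rw [h2, mul_assoc, ← mul_assoc (aeval back f), aeval_back_mul_shift_pow hf, map_mul]

lemma infinite_circle : {z : ℂ | ‖z‖ = 1}.Infinite := by
  have h : IsPreconnected (Metric.sphere (0 : ℂ) 1) :=
    isPreconnected_sphere (by rw [rank_real_complex]; norm_num) _ _
  have : (Metric.sphere (0 : ℂ) 1).Infinite :=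
    h.infinite_of_nontrivial ⟨1, by simp, -1, by simp, by norm_num⟩
  refine this.mono fun z hz => by simpa using hz

lemma eval_reflect_map_conj {f : ℂ[X]} {n : ℕ} (hf : f.natDegree ≤ n) {z : ℂ} (hz : ‖z‖ = 1) :
    ((f.map (starRingEnd ℂ)).reflect n).eval z = z ^ n * conj (f.eval z) := by
  have hz0 : z ≠ 0 := by rintro rfl; simp at hz
  have hi : conj z = z⁻¹ := by rw [inv_def, normSq_eq_norm_sq, hz]; simp
  let u : Invertible (z⁻¹) := invertibleOfNonzero (inv_ne_zero hz0)
  have h := eval₂_reflect_mul_pow (RingHom.id ℂ) z⁻¹ n (f.map (starRingEnd ℂ))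
    (natDegree_map_le.trans hf)
  have hu : ⅟ (z⁻¹) = z := by rw [invOf_eq_inv, inv_inv]
  rw [hu, ← eval, ← eval, ← hi, eval_map_apply, hi] at h
  rw [← h, inv_pow]
  field_simp

/-- Toeplitz operators with analytic polynomial symbols: a relation between the moduli on the
circle gives the corresponding relation between operators. -/
lemma adjoint_mul_self_add {p q d : ℂ[X]}
    (h : ∀ z : ℂ, ‖z‖ = 1 → ‖p.eval z‖ ^ 2 + ‖q.eval z‖ ^ 2 = ‖d.eval z‖ ^ 2) :
    (aeval shift p).adjoint * aeval shift p + (aeval shift q).adjoint * aeval shift q =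
      (aeval shift d).adjoint * aeval shift d := by
  set n := max p.natDegree (max q.natDegree d.natDegree)
  have hp : p.natDegree ≤ n := le_max_left _ _
  have hq : q.natDegree ≤ n := (le_max_left _ _).trans (le_max_right _ _)
  have hd : d.natDegree ≤ n := (le_max_right _ _).trans (le_max_right _ _)
  simp only [adjoint_aeval_shift]
  rw [aeval_back_mul_aeval_shift (natDegree_map_le.trans hp),
    aeval_back_mul_aeval_shift (natDegree_map_le.trans hq),
    aeval_back_mul_aeval_shift (natDegree_map_le.trans hd), ← mul_add, ← map_add]
  congr 2
  refine Polynomial.eq_of_infinite_eval_eq _ _ (infinite_circle.mono fun z hz => ?_)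
  have hz : ‖z‖ = 1 := hz
  simp only [Set.mem_ofPred_eq, eval_add, eval_mul, eval_reflect_map_conj hp hz,
    eval_reflect_map_conj hq hz, eval_reflect_map_conj hd hz, mul_assoc, conj_mul', ← mul_add]
  congr 1
  exact_mod_cast h z hz

/-- An eigenvector of the backward shift is a geometric sequence, which is not square-summable for a
ratio of modulus at least 1 unless it is zero. -/
lemma back_injective_sub {r : ℂ} (hr : 1 ≤ ‖r‖) {x : Hardy} (h : back x = r • x) : x = 0 := by
  have hn (n : ℕ) : x n = r ^ n * x 0 := by
    induction n with
    | zero => simp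
    | succ n ih =>
      rw [← back_apply, h, pow_succ', mul_assoc, ← ih]
      rfl
  have h0 : x 0 = 0 := by
    have h1 := x.summable_sq.tendsto_atTop_zero
    have h2 : ‖x 0‖ ^ 2 ≤ 0 := by
      refine ge_of_tendsto h1 (Eventually.of_forall fun n => ?_)
      rw [hn n, norm_mul, norm_pow]
      have := one_le_pow₀ (n := n) hr
      gcongr
      exact le_mul_of_one_le_left (norm_nonneg _) this
    simpa using le_antisymm h2 (sq_nonneg _)
  ext n
  simp [hn n, h0]

lemma aeval_back_injective {p : ℂ[X]} (hp0 : p ≠ 0) (hp : ∀ z : ℂ, ‖z‖ < 1 → p.eval z ≠ 0) :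
    Function.Injective (aeval back p) := by
  have key : ∀ R : Multiset ℂ, (∀ r ∈ R, 1 ≤ ‖r‖) →
      ∀ x, aeval back (R.map fun r => X - C r).prod x = 0 → x = 0 := by
    intro R
    induction R using Multiset.induction_on with
    | empty => simp
    | cons r R ih =>
      intro hR x hx
      rw [Multiset.map_cons, Multiset.prod_cons, map_mul, mul_apply_eq_comp] at hx
      refine ih (fun s hs => hR s (Multiset.mem_cons_of_mem hs)) x ?_
      refine back_injective_sub (hR r (Multiset.mem_cons_self r R)) (sub_eq_zero.1 ?_)
      simpa [Algebra.algebraMap_eq_smul_one] using hx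
  rw [injective_iff_map_eq_zero]
  intro x hx
  rw [(IsAlgClosed.splits p).eq_prod_roots, map_mul,
    mul_apply_eq_comp, aeval_C, Algebra.algebraMap_eq_smul_one, smul_apply, one_apply_eq_self,
    smul_eq_zero] at hx
  refine key p.roots (fun r hr => ?_) x (hx.resolve_left (leadingCoeff_ne_zero.2 hp0))
  by_contra! hlt
  exact hp r hlt (isRoot_of_mem_roots hr)

/-- For |r| = 1 one has (S^* - conj r) S = 1 - conj r · S = -conj r (S - r); the linear factors are
treated one at a time. -/
lemma aeval_back_map_conj_mul_shift_pow (R : Multiset ℂ) (hR : ∀ r ∈ R, ‖r‖ = 1) :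
    ∃ c : ℂ, c ≠ 0 ∧
      aeval back ((R.map fun r => X - C r).prod.map (starRingEnd ℂ)) * shift ^ R.card =
        c • aeval shift (R.map fun r => X - C r).prod := by
  induction R using Multiset.induction_on with
  | empty => exact ⟨1, one_ne_zero, by simp⟩
  | cons r R ih =>
    obtain ⟨c, hc, h⟩ := ih fun s hs => hR s (Multiset.mem_cons_of_mem hs)
    have hr : ‖r‖ = 1 := hR r (Multiset.mem_cons_self r R)
    have hrr : conj r * r = 1 := by rw [conj_mul', hr]; simp
    refine ⟨-(c * conj r), by simpa using ⟨hc, by rintro rfl; simp at hr⟩, ?_⟩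
    have h1 : (back - algebraMap ℂ _ (conj r)) * shift =
        -(conj r) • (shift - algebraMap ℂ (Hardy →L[ℂ] Hardy) r) := by
      rw [sub_mul, back_mul_shift, Algebra.algebraMap_eq_smul_one, Algebra.algebraMap_eq_smul_one,
        smul_sub, smul_smul, neg_mul, hrr, smul_mul_assoc, one_mul]
      module
    have h2 : aeval shift (R.map fun r => X - C r).prod * shift =
        shift * aeval shift (R.map fun r => X - C r).prod := by
      have := congrArg (aeval shift) (mul_comm (R.map fun r => X - C r).prod X)
      rwa [map_mul, map_mul, aeval_X] at this
    rw [Multiset.map_cons, Multiset.prod_cons, Multiset.card_cons, Polynomial.map_mul, map_mul,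
      pow_succ, mul_assoc, ← mul_assoc _ (shift ^ _), h, smul_mul_assoc, h2, mul_smul_comm,
      ← mul_assoc]
    simp only [Polynomial.map_sub, map_X, map_C, map_sub, aeval_X, aeval_C, map_mul]
    rw [h1, smul_mul_assoc, smul_smul]
    congr 1
    ring

lemma exists_aeval_shift_one_of_back_pow {n : ℕ} : ∀ x : Hardy,
    ∃ r : ℂ[X], x = (shift ^ n) ((back ^ n) x) + aeval shift r one := by
  induction n with
  | zero => exact fun x => ⟨0, by simp⟩
  | succ n ih =>
    intro x
    obtain ⟨r, hr⟩ := ih (back x)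
    refine ⟨C (x 0) + X * r, ?_⟩
    have h := sub_shift_back x
    rw [sub_eq_iff_eq_add'] at h
    conv_lhs => rw [h, hr]
    rw [pow_succ' shift, pow_succ back]
    simp only [map_add, map_mul, aeval_C, aeval_X, mul_apply_eq_comp, add_apply,
      Algebra.algebraMap_eq_smul_one, smul_apply, one_apply_eq_self]
    abel

lemma exists_aeval_back_aeval_shift_one (f r : ℂ[X]) :
    ∃ s : ℂ[X], aeval back f (aeval shift r one) = aeval shift s one := by
  have hb (r : ℂ[X]) : back (aeval shift r one) = aeval shift r.divX one := by
    conv_lhs => rw [← divX_mul_X_add r, mul_comm]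
    simp only [map_add, map_mul, aeval_X, aeval_C, add_apply, mul_apply_eq_comp, back_shift,
      Algebra.algebraMap_eq_smul_one, smul_apply, one_apply_eq_self, map_smul, back_one, smul_zero,
      add_zero]
  induction f using Polynomial.induction_on' with
  | add f g hf hg =>
    obtain ⟨s, hs⟩ := hf
    obtain ⟨t, ht⟩ := hg
    exact ⟨s + t, by simp [hs, ht]⟩
  | monomial n a =>
    have hn : ∃ s : ℂ[X], (back ^ n) (aeval shift r one) = aeval shift s one := by
      induction n with
      | zero => exact ⟨r, by simp⟩
      | succ n ih =>
        obtain ⟨s, hs⟩ := ih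
        exact ⟨s.divX, by rw [pow_succ', mul_apply_eq_comp, hs, hb]⟩
    obtain ⟨s, hs⟩ := hn
    refine ⟨C a * s, ?_⟩
    rw [aeval_monomial, mul_apply_eq_comp, hs]
    simp [Algebra.algebraMap_eq_smul_one]

/-- The range of the co-analytic operator whose symbol is a polynomial with zeros on the circle. -/
lemma exists_aeval_back_eq_iff (R : Multiset ℂ) (hR : ∀ r ∈ R, ‖r‖ = 1) (y : Hardy) :
    (∃ x, y = aeval back ((R.map fun r => X - C r).prod.map (starRingEnd ℂ)) x) ↔
      ∃ (x : Hardy) (r : ℂ[X]), y = aeval shift (R.map fun r => X - C r).prod x +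
        aeval shift r one := by
  obtain ⟨c, hc, h⟩ := aeval_back_map_conj_mul_shift_pow R hR
  have h' (x : Hardy) : aeval back ((R.map fun r => X - C r).prod.map (starRingEnd ℂ))
      ((shift ^ R.card) x) = c • aeval shift (R.map fun r => X - C r).prod x := by
    rw [← mul_apply_eq_comp, h, smul_apply]
  constructor
  · rintro ⟨x, rfl⟩
    obtain ⟨r, hr⟩ := exists_aeval_shift_one_of_back_pow (n := R.card) x
    obtain ⟨s, hs⟩ := exists_aeval_back_aeval_shift_one
      ((R.map fun r => X - C r).prod.map (starRingEnd ℂ)) r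
    refine ⟨c • (back ^ R.card) x, s, ?_⟩
    conv_lhs => rw [hr, map_add, h', hs]
    rw [map_smul]
  · rintro ⟨x, r, rfl⟩
    -- A polynomial is killed by a power of `back`. The symbol does not vanish at 0, so it is
    -- coprime to X^K, and Bézout inverts its operator on this polynomial.
    obtain ⟨K, hK⟩ : ∃ K, (back ^ K) (aeval shift r one) = 0 := by
      induction r using Polynomial.induction_on' with
      | add r s hr hs =>
        obtain ⟨m, hm⟩ := hr
        obtain ⟨n, hn⟩ := hs
        refine ⟨m + n, ?_⟩
        rw [map_add, add_apply, map_add, pow_add]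
        conv_lhs => enter [2]; rw [mul_apply_eq_comp, hn, map_zero]
        rw [(Commute.pow_pow_self back m n).eq, mul_apply_eq_comp, hm, map_zero, add_zero]
      | monomial n a =>
        refine ⟨n + 1, ?_⟩
        have := DFunLike.congr_fun (back_pow_mul_shift_pow n) one
        rw [mul_apply_eq_comp, one_apply_eq_self] at this
        rw [aeval_monomial, Algebra.algebraMap_eq_smul_one, smul_mul_assoc, one_mul, smul_apply,
          map_smul, pow_succ', mul_apply_eq_comp, this, back_one, smul_zero]
    have hcop : IsCoprime ((R.map fun r => X - C r).prod.map (starRingEnd ℂ)) (X ^ K) := by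
      refine IsCoprime.pow_right (IsCoprime.symm ?_)
      refine (irreducible_X.coprime_iff_not_dvd).2 ?_
      rw [X_dvd_iff, coeff_map, map_eq_zero, coeff_zero_eq_eval_zero, eval_multiset_prod,
        Multiset.prod_eq_zero_iff]
      simp only [Multiset.map_map, Multiset.mem_map, Function.comp_apply, eval_sub, eval_X, eval_C, zero_sub,
        neg_eq_zero, not_exists, not_and]
      rintro s hs rfl
      simpa using hR 0 hs
    obtain ⟨u, v, huv⟩ := hcop
    have h1 : aeval back ((R.map fun r => X - C r).prod.map (starRingEnd ℂ))
        (aeval back u (aeval shift r one)) = aeval shift r one := by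
      have := DFunLike.congr_fun (congrArg (aeval back) huv) (aeval shift r one)
      rw [mul_comm u] at this
      simpa [hK] using this
    exact ⟨(shift ^ R.card) (c⁻¹ • x) + aeval back u (aeval shift r one), by
      rw [map_add, h', h1, map_smul, smul_inv_smul₀ hc]⟩

/-- The factor `p₁` gives an invertible operator and does not affect the range; `q` is cancelled by
a Bézout relation with `p₀`. -/
lemma exists_aeval_back_eq_aeval_back_iff {p p₀ p₁ q : ℂ[X]} (hp : p = p₀ * p₁)
    (hp₁ : ∀ z : ℂ, ‖z‖ ≤ 1 → p₁.eval z ≠ 0) (hq : IsCoprime q p₀) (x : Hardy) :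
    (∃ y, aeval back q x = aeval back p y) ↔ ∃ y, x = aeval back p₀ y := by
  have hcomm (f g : ℂ[X]) (v : Hardy) : aeval back f (aeval back g v) = aeval back g (aeval back f v) := by
    rw [← mul_apply_eq_comp, ← mul_apply_eq_comp, ← map_mul, ← map_mul, mul_comm]
  obtain ⟨e, he⟩ := isUnit_aeval norm_back_le hp₁
  have he' (v : Hardy) : aeval back p₁ ((e⁻¹ : (Hardy →L[ℂ] Hardy)ˣ).val v) = v := by
    rw [← he, ← mul_apply_eq_comp, Units.mul_inv, one_apply_eq_self]
  subst hp
  simp only [map_mul, mul_apply_eq_comp]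
  constructor
  · rintro ⟨y, hy⟩
    obtain ⟨u, v, huv⟩ := hq
    refine ⟨aeval back u (aeval back p₁ y) + aeval back v x, ?_⟩
    have := DFunLike.congr_fun (congrArg (aeval back) huv) x
    simp only [map_add, map_mul, add_apply, mul_apply_eq_comp, map_one, one_apply_eq_self] at this
    rw [map_add, hcomm p₀ u, hcomm p₀ v, ← hy, this]
  · rintro ⟨y, rfl⟩
    exact ⟨(e⁻¹ : (Hardy →L[ℂ] Hardy)ˣ).val (aeval back q y), by rw [he', hcomm]⟩

end Hardy

/-! ### Uniqueness of the function space with a given kernel. -/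

namespace RKHS

variable {α : Type*} {H₁ H₂ : Type*}
  [NormedAddCommGroup H₁] [InnerProductSpace ℂ H₁] [CompleteSpace H₁] [RKHS ℂ H₁ α ℂ]
  [NormedAddCommGroup H₂] [InnerProductSpace ℂ H₂] [CompleteSpace H₂] [RKHS ℂ H₂ α ℂ]

lemma kernel_apply_one_of_inner {k : α → H₁} (hk : ∀ w (h : H₁), inner ℂ (k w) h = h w) (z w : α) :
    kernel H₁ z w 1 = k w z := by
  have : kerFun H₁ w (1 : ℂ) = k w := by
    refine ext_inner_right ℂ fun h => ?_
    rw [kerFun_inner, hk]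
    simp
  rw [← kerFun_apply, this]

/-- Two reproducing kernel Hilbert spaces with the same kernel consist of the same functions. -/
lemma exists_coe_eq_of_kernel_eq (hK : ∀ z w : α, kernel H₁ z w (1 : ℂ) = kernel H₂ z w 1) (h : H₁) :
    ∃ h' : H₂, (h' : α → ℂ) = h := by
  let Φ₁ := Finsupp.linearCombination ℂ fun w : α => kerFun H₁ w (1 : ℂ)
  let Φ₂ := Finsupp.linearCombination ℂ fun w : α => kerFun H₂ w (1 : ℂ)
  have hcoe (c : α →₀ ℂ) (z : α) : Φ₁ c z = Φ₂ c z := by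
    induction c using Finsupp.induction_linear with
    | zero => simp
    | add c d hc hd => simp only [map_add, coe_add, Pi.add_apply, hc, hd]
    | single w a =>
      simp only [Φ₁, Φ₂, Finsupp.linearCombination_single, coe_smul, Pi.smul_apply, kerFun_apply, hK]
  have hin₁ (c : α →₀ ℂ) (v : H₁) : inner ℂ (Φ₁ c) v = c.sum fun w a => conj a * v w := by
    simp only [Φ₁, Finsupp.linearCombination_apply, Finsupp.sum_inner]
    refine Finsupp.sum_congr fun w _ => ?_
    rw [inner_smul_left, kerFun_inner]
    simp
  have hin₂ (c : α →₀ ℂ) (v : H₂) : inner ℂ (Φ₂ c) v = c.sum fun w a => conj a * v w := by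
    simp only [Φ₂, Finsupp.linearCombination_apply, Finsupp.sum_inner]
    refine Finsupp.sum_congr fun w _ => ?_
    rw [inner_smul_left, kerFun_inner]
    simp
  -- Norms of combinations of kernel functions depend on the kernel alone, so Cauchy sequences
  -- transfer from one space to the other.
  have hnorm (c : α →₀ ℂ) : ‖Φ₁ c‖ = ‖Φ₂ c‖ := by
    have : (inner ℂ (Φ₁ c) (Φ₁ c) : ℂ) = inner ℂ (Φ₂ c) (Φ₂ c) := by
      rw [hin₁, hin₂]
      simp only [hcoe]
    rw [inner_self_eq_norm_sq_to_K, inner_self_eq_norm_sq_to_K] at this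
    refine (sq_eq_sq₀ (norm_nonneg _) (norm_nonneg _)).1 ?_
    apply ofReal_injective
    push_cast
    exact this
  have hdense : h ∈ closure (Set.range Φ₁) := by
    have h1 : h ∈ (Submodule.span ℂ {kerFun H₁ x v | (x : α) (v : ℂ)}).topologicalClosure := by
      rw [kerFun_dense]; trivial
    have h2 : Submodule.span ℂ {kerFun H₁ x v | (x : α) (v : ℂ)} ≤ LinearMap.range Φ₁ := by
      rw [Submodule.span_le]
      rintro _ ⟨x, v, rfl⟩
      refine ⟨Finsupp.single x v, ?_⟩
      simp [Φ₁, ← map_smul]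
    rw [← LinearMap.coe_range]
    exact closure_mono h2 h1
  obtain ⟨u, hu, hlim⟩ := mem_closure_iff_seq_limit.1 hdense
  choose c hc using hu
  have hcauchy : CauchySeq fun n => Φ₂ (c n) := by
    have h1 := hlim.cauchySeq
    rw [Metric.cauchySeq_iff] at h1 ⊢
    intro ε hε
    obtain ⟨N, hN⟩ := h1 ε hε
    refine ⟨N, fun m hm n hn => ?_⟩
    have := hN m hm n hn
    rwa [dist_eq_norm, ← hc, ← hc, ← map_sub, hnorm, map_sub, ← dist_eq_norm] at this
  obtain ⟨h', hh'⟩ := cauchySeq_tendsto_of_complete hcauchy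
  refine ⟨h', funext fun z => ?_⟩
  have t1 := ((continuous_eval (H := H₁) z).tendsto h).comp hlim
  have t2 := ((continuous_eval (H := H₂) z).tendsto h').comp hh'
  refine tendsto_nhds_unique t2 (t1.congr fun n => ?_)
  simp only [Function.comp_apply, ← hc, hcoe]

end RKHS

/-! ### The graph model of H(b). -/

namespace Hardy

/-- The graph model of the de Branges-Rovnyak space of `b = q / d`, with Pythagorean mate
`a = p / d`: the pairs `(f, g)` in `H² ⊕ H²` with `T_q^* f = T_p^* g`. -/
def pairSpace (p q : ℂ[X]) : Submodule ℂ (WithLp 2 (Hardy × Hardy)) :=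
  LinearMap.ker (((aeval shift q).adjoint ∘L WithLp.fstL 2 ℂ Hardy Hardy -
    (aeval shift p).adjoint ∘L WithLp.sndL 2 ℂ Hardy Hardy :
      WithLp 2 (Hardy × Hardy) →L[ℂ] Hardy) : WithLp 2 (Hardy × Hardy) →ₗ[ℂ] Hardy)

lemma mem_pairSpace {p q : ℂ[X]} {x : WithLp 2 (Hardy × Hardy)} :
    x ∈ pairSpace p q ↔ (aeval shift q).adjoint x.fst = (aeval shift p).adjoint x.snd := by
  simp [pairSpace, sub_eq_zero]

lemma isClosed_pairSpace (p q : ℂ[X]) : IsClosed (pairSpace p q : Set (WithLp 2 (Hardy × Hardy))) :=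
  ContinuousLinearMap.isClosed_ker _

/-- `pairSpace` as a reproducing kernel Hilbert space, through the first component. -/
@[reducible]
def pairSpaceRKHS (p q : ℂ[X]) (hp0 : p ≠ 0) (hp : ∀ z : ℂ, ‖z‖ < 1 → p.eval z ≠ 0) :
    RKHS ℂ (pairSpace p q) 𝔻 ℂ where
  coeCLM := ContinuousLinearMap.pi fun z =>
    ev z ∘L WithLp.fstL 2 ℂ Hardy Hardy ∘L (pairSpace p q).subtypeL
  coeCLM_injective := by
    rw [injective_iff_map_eq_zero]
    rintro ⟨x, hx⟩ h
    have h1 : x.fst = 0 := ext_ev fun z => by simpa using congrFun h z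
    rw [mem_pairSpace, h1, map_zero, adjoint_aeval_shift] at hx
    have h2 : x.snd = 0 := by
      refine aeval_back_injective ?_ ?_ (hx.symm.trans (map_zero _).symm)
      · rwa [Ne, Polynomial.map_eq_zero]
      · intro z hz
        rw [← conj_conj z, eval_map_apply, Ne, map_eq_zero]
        exact hp _ (by simpa using hz)
    apply Subtype.ext
    change x = 0
    exact WithLp.ofLp_injective 2 (Prod.ext h1 h2)

/-- The de Branges-Rovnyak space of a rational function, in terms of Toeplitz operators. -/
lemma mem_deBrangesRovnyak_iff {b : 𝔻 → ℂ} {p q d : ℂ[X]}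
    (hb : ∀ z : 𝔻, b z = q.eval (z : ℂ) / d.eval (z : ℂ))
    (hd : ∀ z : ℂ, ‖z‖ ≤ 1 → d.eval z ≠ 0) (hp0 : p ≠ 0) (hp : ∀ z : ℂ, ‖z‖ < 1 → p.eval z ≠ 0)
    (hpq : ∀ z : ℂ, ‖z‖ = 1 → ‖p.eval z‖ ^ 2 + ‖q.eval z‖ ^ 2 = ‖d.eval z‖ ^ 2) (f : 𝔻 → ℂ) :
    f ∈ deBrangesRovnyak b ↔ ∃ x g : Hardy,
      (aeval shift q).adjoint x = (aeval shift p).adjoint g ∧ ∀ z, f z = ev z x := by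
  have hcomplete : CompleteSpace (pairSpace p q) := (isClosed_pairSpace p q).completeSpace_coe
  let hR : RKHS ℂ (pairSpace p q) 𝔻 ℂ := pairSpaceRKHS p q hp0 hp
  have hcoe (v : pairSpace p q) (z : 𝔻) : v z = ev z v.1.fst := rfl
  choose Y hY hY' using fun w : 𝔻 => exists_ev_eq_div hd (szego w)
  have hadj (r : ℂ[X]) (w : 𝔻) :
      (aeval shift r).adjoint (szego w) = conj (r.eval (w : ℂ)) • szego w := by
    refine ext_inner_right ℂ fun v => ?_
    rw [ContinuousLinearMap.adjoint_inner_left, ← ev_eq_inner, ev_aeval_shift, inner_smul_left,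
      Complex.conj_conj, ev_eq_inner]
  -- The pair representing evaluation at w. As `Y w` is the Szegő kernel divided by d, the first
  -- component is the prescribed kernel; the second is chosen so that the Toeplitz identity puts the
  -- pair in the graph space and so that the two extra inner products cancel.
  let k₀ (w : 𝔻) : WithLp 2 (Hardy × Hardy) := WithLp.toLp 2
    (szego w - conj (b w) • aeval shift q (Y w), conj (b w) • aeval shift p (Y w))
  have hk₀ (w : 𝔻) : k₀ w ∈ pairSpace p q := by
    have h1 := DFunLike.congr_fun (adjoint_mul_self_add hpq) (Y w)
    simp only [add_apply, mul_apply_eq_comp, hY, hadj] at h1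
    rw [mem_pairSpace]
    change (aeval shift q).adjoint (szego w - conj (b w) • aeval shift q (Y w)) =
      (aeval shift p).adjoint (conj (b w) • aeval shift p (Y w))
    rw [map_sub, map_smul, map_smul, hadj, sub_eq_iff_eq_add, ← smul_add, h1, smul_smul, ← map_mul,
      hb, div_mul_cancel₀ _ (hd _ w.norm_lt_one.le)]
  let k (w : 𝔻) : pairSpace p q := ⟨k₀ w, hk₀ w⟩
  have hk (w : 𝔻) (v : pairSpace p q) : inner ℂ (k w) v = v w := by
    have hv := mem_pairSpace.1 v.2
    have h1 : inner ℂ (aeval shift q (Y w)) v.1.fst = (inner ℂ (aeval shift p (Y w)) v.1.snd : ℂ) := by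
      rw [← ContinuousLinearMap.adjoint_inner_right, hv, ContinuousLinearMap.adjoint_inner_right]
    change inner ℂ (k₀ w) v.1 = _
    rw [WithLp.prod_inner_apply]
    change inner ℂ (szego w - conj (b w) • aeval shift q (Y w)) v.1.fst +
      inner ℂ (conj (b w) • aeval shift p (Y w)) v.1.snd = _
    rw [inner_sub_left, inner_smul_left, inner_smul_left, h1, sub_add_cancel, hcoe, ev_eq_inner]
  have hkernel (z w : 𝔻) : RKHS.kernel (pairSpace p q) z w (1 : ℂ) =
      (1 - conj (b w) * b z) / (1 - conj (w : ℂ) * (z : ℂ)) := by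
    rw [RKHS.kernel_apply_one_of_inner hk, hcoe]
    change ev z (szego w - conj (b w) • aeval shift q (Y w)) = _
    rw [map_sub, map_smul, ev_aeval_shift, hY', ev_szego, smul_eq_mul, hb z]
    ring
  constructor
  · rintro ⟨H, _, _, _, _, hH, h, rfl⟩
    obtain ⟨v, hv⟩ := RKHS.exists_coe_eq_of_kernel_eq (H₂ := pairSpace p q)
      (fun z w => (hH z w).trans (hkernel z w).symm) h
    exact ⟨v.1.fst, v.1.snd, mem_pairSpace.1 v.2, fun z => by rw [← hv, hcoe]⟩
  · rintro ⟨x, g, hxg, hf⟩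
    refine ⟨pairSpace p q, inferInstance, inferInstance, hcomplete, hR, hkernel,
      ⟨WithLp.toLp 2 (x, g), mem_pairSpace.2 hxg⟩, funext fun z => ?_⟩
    rw [hf, hcoe]
    rfl

end Hardy

/-! ### Zeros and poles of b and its mate. -/

lemma ratEval_eq (f : RatFunc ℂ) (z : ℂ) : ratEval f z = f.num.eval z / f.denom.eval z := rfl

lemma num_eval_ne_zero_of_denom_eval_eq_zero (f : RatFunc ℂ) {z : ℂ} (h : f.denom.eval z = 0) :
    f.num.eval z ≠ 0 := by
  obtain ⟨u, v, huv⟩ := f.isCoprime_num_denom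
  intro h0
  have := congrArg (eval z) huv
  simp [h, h0] at this

/-- Stated without division, the bound passes by density and continuity to the closed disc and to
possible poles, which it then excludes. -/
lemma HasSupNormOne.norm_num_le {b : RatFunc ℂ} (hb : HasSupNormOne b) {z : ℂ} (hz : ‖z‖ ≤ 1) :
    ‖b.num.eval z‖ ≤ ‖b.denom.eval z‖ := by
  by_contra! hlt
  let U : Set ℂ := {z | ‖b.denom.eval z‖ < ‖b.num.eval z‖}
  have hU : IsOpen U := isOpen_lt (by fun_prop) (by fun_prop)
  have hne : (U ∩ Metric.ball 0 1).Nonempty := by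
    have hcl : z ∈ closure (Metric.ball (0 : ℂ) 1) := by
      rw [closure_ball _ one_ne_zero]
      simpa using hz
    exact mem_closure_iff.1 hcl U hU hlt
  have hden : Dense ((b.denom.roots.toFinset : Set ℂ)ᶜ) :=
    (Finset.countable_toSet _).dense_compl ℂ
  obtain ⟨w, ⟨hwU, hw1⟩, hw⟩ := hden.inter_open_nonempty _ (hU.inter Metric.isOpen_ball) hne
  have hw0 : b.denom.eval w ≠ 0 := by
    intro h0
    exact hw (by simp [b.denom_ne_zero, h0])
  have h1 := hb.1 ⟨UnitDisc.mk w (by simpa using hw1), rfl⟩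
  simp only [UnitDisc.coe_mk, ratEval_eq, norm_div] at h1
  rw [div_le_one (norm_pos_iff.2 hw0)] at h1
  exact absurd hwU (not_lt.2 h1)

lemma HasSupNormOne.denom_eval_ne_zero {b : RatFunc ℂ} (hb : HasSupNormOne b) {z : ℂ}
    (hz : ‖z‖ ≤ 1) : b.denom.eval z ≠ 0 := by
  intro h
  have := hb.norm_num_le hz
  rw [h, norm_zero, norm_le_zero_iff] at this
  exact num_eval_ne_zero_of_denom_eval_eq_zero b h this

/-- A rational function of sup norm `1` on the disc has modulus `1` somewhere on the circle. -/
lemma HasSupNormOne.exists_norm_eq_one {b : RatFunc ℂ} (hb : HasSupNormOne b) :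
    ∃ ζ : ℂ, ‖ζ‖ = 1 ∧ ‖ratEval b ζ‖ = 1 := by
  have hd : DiffContOnCl ℂ (ratEval b) (Metric.ball 0 1) := by
    refine DifferentiableOn.diffContOnCl fun z hz => ?_
    rw [closure_ball _ one_ne_zero, mem_closedBall_zero_iff] at hz
    exact (b.num.differentiable.differentiableAt.div b.denom.differentiable.differentiableAt
      (hb.denom_eval_ne_zero hz)).differentiableWithinAt
  obtain ⟨ζ, hζ, hmax⟩ := Complex.exists_mem_frontier_isMaxOn_norm Metric.isBounded_ball
    (Metric.nonempty_ball.2 one_pos) hd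
  rw [frontier_ball _ one_ne_zero, mem_sphere_zero_iff_norm] at hζ
  refine ⟨ζ, hζ, le_antisymm ?_ (hb.2 ?_)⟩
  · rw [ratEval_eq, norm_div, div_le_one (norm_pos_iff.2 (hb.denom_eval_ne_zero hζ.le))]
    exact hb.norm_num_le hζ.le
  · rintro _ ⟨z, rfl⟩
    exact hmax (subset_closure (by simpa using z.norm_lt_one))

lemma IsOuter.ne_zero {f : ℂ → ℂ} (hf : IsOuter f) (z : 𝔻) : f z ≠ 0 := by
  obtain ⟨-, c, hc, h⟩ := hf
  rw [h]
  exact mul_ne_zero (by rintro rfl; simp at hc) (exp_ne_zero _)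

/-- A relation between moduli of polynomials on the circle extends to finitely many exceptional
points. -/
lemma norm_sq_add_eq_of_finite {p q d : ℂ[X]} {S : Set ℂ} (hS : S.Finite)
    (h : ∀ z : ℂ, ‖z‖ = 1 → z ∉ S → ‖p.eval z‖ ^ 2 + ‖q.eval z‖ ^ 2 = ‖d.eval z‖ ^ 2)
    {z : ℂ} (hz : ‖z‖ = 1) : ‖p.eval z‖ ^ 2 + ‖q.eval z‖ ^ 2 = ‖d.eval z‖ ^ 2 := by
  set n := max p.natDegree (max q.natDegree d.natDegree)
  have hp : p.natDegree ≤ n := le_max_left _ _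
  have hq : q.natDegree ≤ n := (le_max_left _ _).trans (le_max_right _ _)
  have hd : d.natDegree ≤ n := (le_max_right _ _).trans (le_max_right _ _)
  have hev {w : ℂ} (hw : ‖w‖ = 1) {f : ℂ[X]} (hf : f.natDegree ≤ n) :
      ((f.map (starRingEnd ℂ)).reflect n * f).eval w = w ^ n * ((‖f.eval w‖ ^ 2 : ℝ) : ℂ) := by
    rw [eval_mul, eval_reflect_map_conj hf hw, mul_assoc, conj_mul', ofReal_pow]
  have key : (p.map (starRingEnd ℂ)).reflect n * p + (q.map (starRingEnd ℂ)).reflect n * q =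
      (d.map (starRingEnd ℂ)).reflect n * d := by
    refine Polynomial.eq_of_infinite_eval_eq _ _ ((infinite_circle.sdiff hS).mono ?_)
    rintro w ⟨hw, hwS⟩
    have hw : ‖w‖ = 1 := hw
    change eval w _ = eval w _
    rw [eval_add, hev hw hp, hev hw hq, hev hw hd, ← mul_add, ← ofReal_add, h w hw hwS]
  have := congrArg (eval z) key
  rw [eval_add, hev hz hp, hev hz hq, hev hz hd, ← mul_add, ← ofReal_add] at this
  exact ofReal_injective (mul_left_cancel₀ (pow_ne_zero _ (by rintro rfl; simp at hz)) this)

lemma IsPythagoreanMate.norm_sq_add {a b : RatFunc ℂ} (hb : HasSupNormOne b)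
    (ha : IsPythagoreanMate a b) {z : ℂ} (hz : ‖z‖ = 1) :
    ‖(a.num * b.denom).eval z‖ ^ 2 + ‖(b.num * a.denom).eval z‖ ^ 2 =
      ‖(a.denom * b.denom).eval z‖ ^ 2 := by
  -- Circle poles of `a` are not yet excluded, so the identity is cleared of denominators away from
  -- them and then extended.
  refine norm_sq_add_eq_of_finite (S := a.denom.roots.toFinset) (Finset.finite_toSet _)
    (fun w hw hwS => ?_) hz
  have ha0 : ‖a.denom.eval w‖ ≠ 0 := by
    rw [norm_ne_zero_iff]
    intro h0
    exact hwS (by simp [a.denom_ne_zero, h0])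
  have hb0 : ‖b.denom.eval w‖ ≠ 0 := norm_ne_zero_iff.2 (hb.denom_eval_ne_zero hw.le)
  have h1 := ha.2.2.2 w hw
  simp only [ratEval_eq, norm_div] at h1
  field_simp at h1
  simp only [eval_mul, norm_mul]
  linear_combination h1

/-- Inside the disc, the convention x / 0 = 0 would turn a pole into a zero of an outer function. On
the circle, the cleared identity would make the numerator vanish too. -/
lemma IsPythagoreanMate.denom_eval_ne_zero {a b : RatFunc ℂ} (hb : HasSupNormOne b)
    (ha : IsPythagoreanMate a b) {z : ℂ} (hz : ‖z‖ ≤ 1) : a.denom.eval z ≠ 0 := by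
  rcases hz.lt_or_eq with h | h
  · intro h0
    refine ha.1.ne_zero (UnitDisc.mk z h) ?_
    rw [UnitDisc.coe_mk, ratEval_eq, h0, div_zero]
  · intro h0
    have h1 := ha.norm_sq_add hb h
    simp only [eval_mul, h0, mul_zero, zero_mul, norm_zero, ne_eq, OfNat.ofNat_ne_zero,
      not_false_eq_true, zero_pow, add_zero, pow_eq_zero_iff, norm_eq_zero] at h1
    exact (mul_ne_zero (num_eval_ne_zero_of_denom_eval_eq_zero a h0)
      (hb.denom_eval_ne_zero hz)) h1

lemma IsPythagoreanMate.num_eval_ne_zero {a b : RatFunc ℂ} (ha : IsPythagoreanMate a b) {z : ℂ}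
    (hz : ‖z‖ < 1) : a.num.eval z ≠ 0 := by
  intro h0
  refine ha.1.ne_zero (UnitDisc.mk z hz) ?_
  rw [UnitDisc.coe_mk, ratEval_eq, h0, zero_div]

lemma IsPythagoreanMate.num_ne_zero {a b : RatFunc ℂ} (ha : IsPythagoreanMate a b) : a.num ≠ 0 := by
  intro h
  exact ha.num_eval_ne_zero (z := 0) (by simp) (by simp [h])

lemma IsPythagoreanMate.ratEval_eq_zero_iff {a b : RatFunc ℂ} (hb : HasSupNormOne b)
    (ha : IsPythagoreanMate a b) {ζ : ℂ} (hζ : ‖ζ‖ = 1) :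
    ratEval a ζ = 0 ↔ a.num.eval ζ = 0 := by
  rw [ratEval_eq, div_eq_zero_iff, or_iff_left (ha.denom_eval_ne_zero hb hζ.le)]

/-- The zeros on the circle, with multiplicities, of the Pythagorean mate. -/
def circleZeros (a : RatFunc ℂ) : Multiset ℂ :=
  open Classical in a.num.roots.filter fun r => ‖r‖ = 1

lemma norm_eq_one_of_mem_circleZeros {a : RatFunc ℂ} {r : ℂ} (h : r ∈ circleZeros a) : ‖r‖ = 1 :=
  (Multiset.mem_filter.1 h).2

open Classical in
lemma count_circleZeros (a : RatFunc ℂ) {ζ : ℂ} (hζ : ‖ζ‖ = 1) :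
    (circleZeros a).count ζ = zeroMultiplicity a ζ := by
  rw [circleZeros, Multiset.count_filter_of_pos (p := fun r : ℂ => ‖r‖ = 1) hζ, count_roots, zeroMultiplicity]

lemma exists_num_eq_mul (a : RatFunc ℂ) (ha : a.num ≠ 0)
    (h : ∀ z : ℂ, ‖z‖ < 1 → a.num.eval z ≠ 0) :
    ∃ p₁ : ℂ[X], a.num = ((circleZeros a).map fun r => X - C r).prod * p₁ ∧
      ∀ z : ℂ, ‖z‖ ≤ 1 → p₁.eval z ≠ 0 := by
  classical
  refine ⟨C a.num.leadingCoeff *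
    ((a.num.roots.filter fun r => ¬ ‖r‖ = 1).map fun r => X - C r).prod, ?_, fun z hz => ?_⟩
  · conv_lhs => rw [(IsAlgClosed.splits a.num).eq_prod_roots,
      ← Multiset.filter_add_not (fun r => ‖r‖ = 1) a.num.roots, Multiset.map_add, Multiset.prod_add]
    rw [mul_left_comm]
    congr! 3
  · rw [eval_mul, eval_C, eval_multiset_prod, mul_ne_zero_iff]
    refine ⟨leadingCoeff_ne_zero.2 ha, ?_⟩
    rw [Ne, Multiset.prod_eq_zero_iff]
    simp only [Multiset.map_map, Multiset.mem_map, Multiset.mem_filter, Function.comp_apply,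
      eval_sub, eval_X, eval_C, not_exists, not_and]
    rintro r ⟨hr, hr1⟩ h0
    rw [← sub_eq_zero.1 h0] at hr hr1
    exact h z (lt_of_le_of_ne hz hr1) (isRoot_of_mem_roots hr)

/-- The de Branges-Rovnyak space of a rational function consists of the functions `p₀ h + r`, with
`p₀` the monic polynomial of the zeros of the mate on the circle, `h ∈ H²` and `r` a polynomial. -/
lemma mem_deBrangesRovnyak_ratEval_iff {a b : RatFunc ℂ} (hb : HasSupNormOne b)
    (ha : IsPythagoreanMate a b) (f : 𝔻 → ℂ) :
    (f ∈ deBrangesRovnyak fun z : 𝔻 => ratEval b z) ↔ ∃ (x : Hardy) (r : ℂ[X]), ∀ z : 𝔻,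
      f z = (((circleZeros a).map fun r => X - C r).prod).eval (z : ℂ) * ev z x +
        r.eval (z : ℂ) := by
  set R := circleZeros a
  set p₀ := (R.map fun r => X - C r).prod with hp₀
  have hR : ∀ r ∈ R, ‖r‖ = 1 := fun r hr => norm_eq_one_of_mem_circleZeros hr
  obtain ⟨p₁, hp₁, hp₁'⟩ := exists_num_eq_mul a ha.num_ne_zero fun z hz => ha.num_eval_ne_zero hz
  have hpq : ∀ z : ℂ, ‖z‖ = 1 → _ := fun z hz => ha.norm_sq_add hb hz
  have hd : ∀ z : ℂ, ‖z‖ ≤ 1 → (a.denom * b.denom).eval z ≠ 0 := fun z hz => by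
    rw [eval_mul]
    exact mul_ne_zero (ha.denom_eval_ne_zero hb hz) (hb.denom_eval_ne_zero hz)
  rw [mem_deBrangesRovnyak_iff (p := a.num * b.denom) (q := b.num * a.denom)
    (d := a.denom * b.denom) ?_ hd (mul_ne_zero ha.num_ne_zero b.denom_ne_zero) ?_ hpq]
  rotate_left
  · intro z
    have h1 := ha.denom_eval_ne_zero hb z.norm_lt_one.le
    rw [ratEval_eq, eval_mul, eval_mul, mul_comm (eval _ a.denom), mul_div_mul_right _ _ h1]
  · intro z hz
    rw [eval_mul]
    exact mul_ne_zero (ha.num_eval_ne_zero hz) (hb.denom_eval_ne_zero hz.le)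
  -- At a circle zero of `a` the identity on the circle gives |q| = |d|, which is nonzero.
  have hcop : IsCoprime (b.num * a.denom) p₀ := by
    have key : ∀ T : Multiset ℂ, (∀ r ∈ T, r ∈ R) →
        IsCoprime (b.num * a.denom) (T.map fun r => X - C r).prod := by
      intro T
      induction T using Multiset.induction_on with
      | empty => exact fun _ => by simpa using isCoprime_one_right
      | cons r T ih =>
        intro hT
        rw [Multiset.map_cons, Multiset.prod_cons]
        refine IsCoprime.mul_right ?_ (ih fun s hs => hT s (Multiset.mem_cons_of_mem hs))
        have hrR := hT r (Multiset.mem_cons_self r T)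
        refine ((irreducible_X_sub_C r).coprime_iff_not_dvd.2 ?_).symm
        rw [dvd_iff_isRoot]
        intro h0
        have h1 := hpq r (hR r hrR)
        have h2 : a.num.eval r = 0 := isRoot_of_mem_roots (Multiset.mem_filter.1 hrR).1
        rw [IsRoot.def.1 h0, eval_mul (p := a.num), h2, zero_mul] at h1
        simp only [norm_zero, ne_eq, OfNat.ofNat_ne_zero, not_false_eq_true, zero_pow, add_zero] at h1
        exact hd r (hR r hrR).le (by simpa using h1.symm)
    exact key R fun _ h => h
  have hcop' := hcop.map (mapRingHom (starRingEnd ℂ))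
  have hp : (a.num * b.denom).map (starRingEnd ℂ) = p₀.map (starRingEnd ℂ) *
      (p₁ * b.denom).map (starRingEnd ℂ) := by
    rw [← Polynomial.map_mul, ← mul_assoc, hp₁]
  have hroot : ∀ z : ℂ, ‖z‖ ≤ 1 → ((p₁ * b.denom).map (starRingEnd ℂ)).eval z ≠ 0 := by
    intro z hz
    rw [← Complex.conj_conj z, eval_map_apply, Ne, map_eq_zero, eval_mul]
    have hz' : ‖conj z‖ ≤ 1 := by simpa using hz
    exact mul_ne_zero (hp₁' _ hz') (hb.denom_eval_ne_zero hz')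
  have hmain (x : Hardy) := (exists_aeval_back_eq_aeval_back_iff hp hroot hcop' x).trans
    (exists_aeval_back_eq_iff R hR x)
  simp only [coe_mapRingHom] at hmain
  simp only [adjoint_aeval_shift]
  constructor
  · rintro ⟨x, g, hxg, hf⟩
    obtain ⟨y, r, rfl⟩ := (hmain x).1 ⟨g, hxg⟩
    exact ⟨y, r, fun z => by rw [hf, map_add, ev_aeval_shift, ev_aeval_shift, ev_one, mul_one]⟩
  · rintro ⟨y, r, hf⟩
    obtain ⟨g, hg⟩ := (hmain _).2 ⟨y, r, rfl⟩
    exact ⟨_, g, hg, fun z => by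
      rw [hf, map_add, ev_aeval_shift, ev_aeval_shift, ev_one, mul_one]⟩

/-! ### Gluing the local expansions, and conclusion. -/

/-- Local expansions at the zeros of a polynomial glue to a global one. -/
lemma exists_eq_eval_add_of_local (R : Multiset ℂ) {B : 𝔻 → ℂ} {h₀ : Hardy} (h₀B : ∀ z, B z = ev z h₀)
    (hloc : ∀ ζ ∈ R, ∃ (p : ℂ[X]) (h : Hardy), ∀ z : 𝔻,
      B z = p.eval (z : ℂ) + (z - ζ) ^ ((R.map fun r => X - C r).prod.rootMultiplicity ζ) * ev z h) :
    ∃ (r : ℂ[X]) (h : Hardy), ∀ z : 𝔻,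
      B z = r.eval (z : ℂ) + ((R.map fun r => X - C r).prod).eval (z : ℂ) * ev z h := by
  set p₀ := (R.map fun r => X - C r).prod with hp₀
  have hp₀0 : p₀ ≠ 0 := (monic_multiset_prod_of_monic _ _ fun r _ => monic_X_sub_C r).ne_zero
  -- The polynomials u for which uB has a global expansion. This ideal contains `p₀` and, for each
  -- zero ζ, the cofactor of the power of X - ζ in `p₀`; its generator therefore has no root, and 1
  -- lies in it.
  let J : Ideal ℂ[X] :=
    { carrier := {u | ∃ (r : ℂ[X]) (h : Hardy), ∀ z : 𝔻,
        u.eval (z : ℂ) * B z = r.eval (z : ℂ) + p₀.eval (z : ℂ) * ev z h}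
      zero_mem' := ⟨0, 0, fun z => by simp⟩
      add_mem' := by
        rintro u v ⟨r, h, hu⟩ ⟨s, k, hv⟩
        exact ⟨r + s, h + k, fun z => by rw [eval_add, add_mul, hu, hv, eval_add, map_add]; ring⟩
      smul_mem' := by
        rintro c u ⟨r, h, hu⟩
        exact ⟨c * r, aeval shift c h, fun z => by
          rw [smul_eq_mul, eval_mul, mul_assoc, hu, eval_mul, ev_aeval_shift]; ring⟩ }
  have hp₀J : p₀ ∈ J := ⟨0, h₀, fun z => by rw [h₀B]; simp⟩
  have hlocJ : ∀ ζ ∈ R, ∃ u ∈ J, u.eval ζ ≠ 0 := by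
    intro ζ hζ
    obtain ⟨p, h, hp⟩ := hloc ζ hζ
    obtain ⟨u, hu, hdvd⟩ := exists_eq_pow_rootMultiplicity_mul_and_not_dvd p₀ hp₀0 ζ
    refine ⟨u, ⟨u * p, h, fun z => ?_⟩, fun h0 => hdvd (dvd_iff_isRoot.2 h0)⟩
    have : p₀.eval (z : ℂ) = (z - ζ) ^ p₀.rootMultiplicity ζ * u.eval (z : ℂ) := by
      conv_lhs => rw [hu]
      simp
    rw [hp, this, eval_mul]
    ring
  have htop : J = ⊤ := by
    obtain ⟨g, hg⟩ := (IsPrincipalIdealRing.principal J).principal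
    have hmem (u : ℂ[X]) : u ∈ J ↔ g ∣ u := by rw [hg]; exact Ideal.mem_span_singleton
    have hdeg : g.degree = 0 := by
      by_contra hne
      obtain ⟨ζ, hζ⟩ := IsAlgClosed.exists_root g hne
      have h1 : p₀.eval ζ = 0 := (IsRoot.dvd hζ ((hmem _).1 hp₀J))
      have hζR : ζ ∈ R := by
        rw [hp₀, eval_multiset_prod, Multiset.prod_eq_zero_iff] at h1
        simp only [Multiset.map_map, Multiset.mem_map, Function.comp_apply, eval_sub, eval_X,
          eval_C] at h1
        obtain ⟨r, hr, hr0⟩ := h1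
        rwa [sub_eq_zero.1 hr0]
      obtain ⟨u, huJ, hu⟩ := hlocJ ζ hζR
      exact hu (IsRoot.dvd hζ ((hmem _).1 huJ))
    rw [Ideal.eq_top_iff_one, hmem]
    exact (isUnit_iff_degree_eq_zero.2 hdeg).dvd
  obtain ⟨r, h, hr⟩ := (htop ▸ Submodule.mem_top : (1 : ℂ[X]) ∈ J)
  exact ⟨r, h, fun z => by simpa using hr z⟩

end

theorem mainTheorem5 (Λ : ℕ → 𝔻) :
    (∀ ζ : ℂ, ‖ζ‖ = 1 → ∀ N : ℕ, 1 ≤ N → SummableAt Λ ζ N →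
      (∀ z : 𝔻, Multipliable fun n => blaschkeFactor (Λ n) z) ∧
      localDirichletIntegral N ζ (blaschkeProduct Λ) < ⊤ ∧
      HasUnimodularRadialLimit (blaschkeProduct Λ) ζ) ∧
    (∀ a b : RatFunc ℂ, HasSupNormOne b → IsNonextreme (ratEval b) → IsPythagoreanMate a b →
      (∀ ζ : ℂ, ‖ζ‖ = 1 → ratEval a ζ = 0 → SummableAt Λ ζ (zeroMultiplicity a ζ)) →
      (∀ z : 𝔻, Multipliable fun n => blaschkeFactor (Λ n) z) ∧
      (∀ ζ : ℂ, ‖ζ‖ = 1 → ratEval a ζ = 0 →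
        localDirichletIntegral (zeroMultiplicity a ζ) ζ (blaschkeProduct Λ) < ⊤ ∧
        HasUnimodularRadialLimit (blaschkeProduct Λ) ζ) ∧
      (fun z : 𝔻 => blaschkeProduct Λ z) ∈ deBrangesRovnyak (fun z : 𝔻 => ratEval b z) ∧
      (fun z : 𝔻 => blaschkeProduct Λ z) ∈
        multipliers (deBrangesRovnyak fun z : 𝔻 => ratEval b z)) := by
  refine ⟨fun ζ hζ N hN hs => ⟨multipliable_blaschkeFactor (hs.summable_one_sub hζ),
    hs.localDirichletIntegral_lt_top hζ hN, hs.hasUnimodularRadialLimit hζ hN⟩,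
    fun a b hb _ ha hs => ?_⟩
  -- The maximum principle supplies at least one circle zero of `a`. Without one the summability
  -- hypothesis would be vacuous and would not give the Blaschke condition.
  obtain ⟨ζ₀, hζ₀, hbζ₀⟩ := hb.exists_norm_eq_one
  have haζ₀ : ratEval a ζ₀ = 0 := by
    have := ha.2.2.2 ζ₀ hζ₀
    simpa [hbζ₀] using this
  have hsum := (hs ζ₀ hζ₀ haζ₀).summable_one_sub hζ₀
  have hmult : ∀ ζ : ℂ, ‖ζ‖ = 1 → ratEval a ζ = 0 → 1 ≤ zeroMultiplicity a ζ := fun ζ hζ h0 =>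
    (rootMultiplicity_pos ha.num_ne_zero).2 ((ha.ratEval_eq_zero_iff hb hζ).1 h0)
  have hroot : ∀ ζ : ℂ, ‖ζ‖ = 1 →
      ((circleZeros a).map fun r => X - C r).prod.rootMultiplicity ζ = zeroMultiplicity a ζ := by
    classical
    intro ζ hζ
    rw [← count_circleZeros a hζ, ← count_roots, roots_multiset_prod_X_sub_C]
  obtain ⟨h₀, hh₀⟩ := exists_ev_eq_blaschkeProduct_mul hsum Hardy.one
  obtain ⟨P, h, hB⟩ := exists_eq_eval_add_of_local (circleZeros a)
    (B := fun z : 𝔻 => blaschkeProduct Λ z) (h₀ := h₀)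
    (fun z => by rw [hh₀, Hardy.ev_one, mul_one]) fun ζ hζ => by
      have hζ1 := norm_eq_one_of_mem_circleZeros hζ
      have h0 : ratEval a ζ = 0 := (ha.ratEval_eq_zero_iff hb hζ1).2
        (isRoot_of_mem_roots (Multiset.mem_filter.1 hζ).1)
      obtain ⟨p, -, h, -, hp⟩ := (hs ζ hζ1 h0).exists_taylor hζ1 (hmult ζ hζ1 h0)
      exact ⟨p, h, fun z => by rw [hp, hroot ζ hζ1]⟩
  refine ⟨multipliable_blaschkeFactor hsum, fun ζ hζ h0 =>
    ⟨(hs ζ hζ h0).localDirichletIntegral_lt_top hζ (hmult ζ hζ h0),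
      (hs ζ hζ h0).hasUnimodularRadialLimit hζ (hmult ζ hζ h0)⟩, ?_, fun f hf => ?_⟩
  · exact (mem_deBrangesRovnyak_ratEval_iff hb ha _).2 ⟨h, P, fun z => by
      rw [add_comm]; exact hB z⟩
  · obtain ⟨x, r, hf⟩ := (mem_deBrangesRovnyak_ratEval_iff hb ha f).1 hf
    obtain ⟨y, hy⟩ := exists_ev_eq_blaschkeProduct_mul hsum x
    -- With B = P + p₀h only the term rB is expanded: B(p₀x + r) = p₀(Bx + rh) + Pr.
    refine (mem_deBrangesRovnyak_ratEval_iff hb ha _).2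
      ⟨y + aeval Hardy.shift r h, P * r, fun z => ?_⟩
    have hBz : blaschkeProduct Λ z = _ := hB z
    rw [Pi.mul_apply, hf, mul_add, mul_left_comm, ← hy, map_add, Hardy.ev_aeval_shift, eval_mul, hBz]
    ring
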